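/- Let $K$ be a local field of characteristic $p>0$ (locally compact, non-discrete, totally disconnected, hence with ultrametric absolute value $|\cdot|$), $\mathfrak D=\{|x|\le 1\}$, $\mathfrak B=\{|x|<1\}=\mathfrak p\mathfrak D$ with prime element $\mathfrak p$, $q=p^c=|\mathfrak D/\mathfrak B|$, and $dx$ the Haar measure of $K^+$ with $|\mathfrak D|=1$. Let $\zeta_0=1,\zeta_1,\dots,\zeta_{c-1}\in\mathfrak D\setminus\mathfrak B$ be a basis over the prime field of a subfield $GF(q)\subset K$ representing $\mathfrak D/\mathfrak B$, and let $\chi$ be the continuous character of $K^+$ with $\chi(\zeta_0\mathfrak p^{-1})=e^{2\pi i/p}$ and $\chi(\zeta_\mu\mathfrak p^{-j})=1$ if $\mu\ne0$ or $j\neq 1$ ($0\le\mu<c$, $j\in\mathbb Z$). For $0\le n<q$, $n=\sum_{i<c}a_ip^i$ with $0\le a_i<p$, put $u(n)=\big(\sum_i a_i\zeta_i\big)\mathfrak p^{-1}$, and for $n=\sum_s b_sq^s$ with $0\le b_s<q$ put $u(n)=\sum_s u(b_s)\mathfrak p^{-s}$. Let $\hat f(\xi)=\int_K f(x)\overline{\chi(\xi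 x)}\,dx$, extended to $L^2(K)$ by Plancherel. Let $L\in\mathbb N$ and let $m_\ell(\xi)=\frac1{\sqrt q}\sum_{k\ge0}d^\ell_k\overline{\chi(u(k)\xi)}$ and $\tilde m_\ell(\xi)=\frac1{\sqrt q}\sum_{k\ge0}\tilde d^\ell_k\overline{\chi(u(k)\xi)}$, $\ell=0,\dots,L$, be masks, the series converging in $L^2$ on every ball. Let $\varphi,\tilde\varphi\in L^2(K)$ be refinable functions with masks $m_0,\tilde m_0$, that is, $\varphi(x)=\sqrt q\sum_{k\ge0} d^0_k\,\varphi(\mathfrak p^{-1}x-u(k))$ in $L^2(K)$ and likewise for $\tilde\varphi$ with the coefficients $\tilde d^0_k$, and suppose that $\lim_{j\to\infty}|\hat\varphi(\mathfrak p^j\xi)|=\lim_{j\to\infty}|\hat{\tilde\varphi}(\mathfrak p^j\xi)|=1$ for a.e. $\xi\in K$. For $k=1,\dots,q-1$ let $$\mathcal M_k(\xi)=\big(m_\ell(\xi),\ m_\ell(\xi+\mathfrak pu(k))\big)_{\ell=0}^{L},\qquad \mathcal M_{0,k}(\xi)=\big(m_\ell(\xi),\ m_\ell(\xi+\mathfrak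 pu(k))\big)_{\ell=1}^{L}$$ be the two-column matrices with rows indexed by $\ell$, and define $\tilde{\mathcal M}_k,\tilde{\mathcal M}_{0,k}$ in the same way from $\tilde m_\ell$. Suppose that for every $k=1,\dots,q-1$ and a.e. $\xi\in K$ $$\mathcal M_k^*(\xi)\mathcal M_k(\xi)=I_2,\qquad \tilde{\mathcal M}_k^*(\xi)\tilde{\mathcal M}_k(\xi)=I_2,\qquad \mathcal M_{0,k}^*(\xi)\tilde{\mathcal M}_{0,k}(\xi)=0.$$ For $1\le\ell\le L$ let $\psi_\ell,\phi_\ell\in L^2(K)$ be given by $\hat\psi_\ell(\xi)=m_\ell(\mathfrak p\xi)\hat\varphi(\mathfrak p\xi)$ and $\hat\phi_\ell(\xi)=\tilde m_\ell(\mathfrak p\xi)\hat{\tilde\varphi}(\mathfrak p\xi)$, and write $\psi_{\ell,j,k}(x)=q^{j/2}\psi_\ell(\mathfrak p^{-j}x-u(k))$ and $\phi_{\ell,j,k}(x)=q^{j/2}\phi_\ell(\mathfrak p^{-j}x-u(k))$ for $j\in\mathbb Z$, $k\in\mathbb N_0$. Then $\{\psi_{\ell,j,k}\}$ and $\{\phi_{\ell,j,k}\}$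 are Parseval frames for $L^2(K)$, i.e. $\sum_{\ell,j,k}|\langle f,\psi_{\ell,j,k}\rangle|^2=\|f\|_2^2=\sum_{\ell,j,k}|\langle f,\phi_{\ell,j,k}\rangle|^2$ for all $f\in L^2(K)$, and they are orthogonal: for every $f\in L^2(K)$, $\sum_{\ell,j,k}\langle f,\psi_{\ell,j,k}\rangle\,\phi_{\ell,j,k}=0$ with unconditional convergence in $L^2(K)$. -/

import Mathlib

open MeasureTheory Filter Topology
open scoped ComplexConjugate Matrix

/-- The choices made once and for all in a local field `K` of characteristic `p` whose residue
field has `q = p ^ c` elements: a prime element `𝔭`, elements `ζ₀ = 1, ζ₁, …, ζ_{c-1}` of norm one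
whose span over the prime field is a subfield `F ≅ GF(q)` of `K` representing the residue field,
and the additive character `χ` of `K` determined by its values on the `ζ_μ 𝔭 ^ (-j)`. -/
structure LocalFieldData (K : Type*) [NontriviallyNormedField K] (p c : ℕ) where
  /-- the prime element -/
  𝔭 : K
  norm_prime_lt_one : ‖𝔭‖ < 1
  norm_le_norm_prime : ∀ x : K, ‖x‖ < 1 → ‖x‖ ≤ ‖𝔭‖
  /-- the basis of the coefficient field -/
  ζ : Fin c → K
  ζ_zero : ∀ i : Fin c, i.val = 0 → ζ i = 1
  norm_ζ : ∀ i : Fin c, ‖ζ i‖ = 1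
  /-- the coefficient field, a copy of the residue field -/
  F : Subfield K
  /-- every element of `F` is `∑ a_i ζ_i` for unique `0 ≤ a_i < p` -/
  span_ζ : Set.BijOn (fun a : Fin c → Fin p => ∑ i, ((a i : ℕ) : K) * ζ i) Set.univ (F : Set K)
  /-- `F` maps onto the residue field `𝔇 / 𝔅` -/
  residue : ∀ x : K, ‖x‖ ≤ 1 → ∃ a ∈ F, ‖x - a‖ < 1
  /-- the fixed additive character -/
  χ : AddChar K Circle
  continuous_χ : Continuous χ
  χ_apply : ∀ (i : Fin c) (j : ℤ), (χ (ζ i * 𝔭 ^ (-j)) : ℂ) =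
    if i.val = 0 ∧ j = 1 then Complex.exp (2 * Real.pi * Complex.I / p) else 1

namespace LocalFieldData

variable {K : Type*} [NontriviallyNormedField K] {p c : ℕ} (E : LocalFieldData K p c)

/-- `u(b) = (a₀ + a₁ ζ₁ + ⋯ + a_{c-1} ζ_{c-1}) 𝔭⁻¹` for `0 ≤ b < q` with base-`p` digits `a_i`. -/
def uDigit (b : ℕ) : K :=
  (∑ i : Fin c, ((b / p ^ (i : ℕ) % p : ℕ) : K) * E.ζ i) * E.𝔭⁻¹

/-- `u(n) = ∑ₛ u(bₛ) 𝔭⁻ˢ`, where `bₛ = n / q ^ s % q` are the base-`q` digits of `n`, `q = p ^ c`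
(the digits with `s > n` are zero). -/
def u (n : ℕ) : K :=
  ∑ s ∈ Finset.range (n + 1), E.uDigit (n / (p ^ c) ^ s % p ^ c) * E.𝔭⁻¹ ^ s

variable [MeasurableSpace K] (μ : Measure K)

/-- `g` is (a representative of) the Fourier transform of `f ∈ L²(K)`: the `L²`-limit of the
Fourier integrals `∫ f(x) conj (χ(ξ x)) dx` over growing balls. -/
def IsFourierTransform (f g : K → ℂ) : Prop :=
  MemLp f 2 μ ∧ MemLp g 2 μ ∧
    Tendsto (fun n : ℕ => eLpNorm
      (fun ξ => g ξ - ∫ x in Metric.closedBall (0 : K) n, f x * conj (E.χ (ξ * x) : ℂ) ∂μ) 2 μ)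
      atTop (𝓝 0)

/-- `φ ∈ L²(K)` is refinable with coefficients `a`:
`φ(x) = √q ∑ₖ aₖ φ(𝔭⁻¹ x - u(k))` in `L²(K)`. -/
def IsRefinable (a : ℕ → ℂ) (φ : K → ℂ) : Prop :=
  MemLp φ 2 μ ∧
    Tendsto (fun N : ℕ => eLpNorm
      (fun x => φ x - (Real.sqrt ((p : ℝ) ^ c) : ℂ) *
        ∑ k ∈ Finset.range N, a k * φ (E.𝔭⁻¹ * x - E.u k)) 2 μ)
      atTop (𝓝 0)

/-- `m` is the mask `m(ξ) = (1/√q) ∑ₖ aₖ conj (χ(u(k) ξ))`, the series converging in `L²` on every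
ball. -/
def IsMask (a : ℕ → ℂ) (m : K → ℂ) : Prop :=
  AEStronglyMeasurable m μ ∧
    ∀ R : ℝ, Tendsto (fun N : ℕ => eLpNorm
      (fun ξ => m ξ - (Real.sqrt ((p : ℝ) ^ c) : ℂ)⁻¹ *
        ∑ k ∈ Finset.range N, a k * conj (E.χ (E.u k * ξ) : ℂ)) 2
        (μ.restrict (Metric.closedBall (0 : K) R)))
      atTop (𝓝 0)

/-- The wavelet system `ψ_{ℓ,j,k}(x) = q^{j/2} ψ_ℓ(𝔭⁻ʲ x - u(k))`, indexed by `(ℓ, j, k)`. -/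
noncomputable def waveletSystem {L : ℕ} (ψ : Fin L → K → ℂ) (i : Fin L × ℤ × ℕ) (x : K) : ℂ :=
  ((Real.sqrt ((p : ℝ) ^ c) ^ i.2.1 : ℝ) : ℂ) * ψ i.1 (E.𝔭 ^ (-i.2.1) * x - E.u i.2.2)

/-- The wavelet coefficient `⟨f, ψ_{ℓ,j,k}⟩`. -/
noncomputable def waveletCoeff {L : ℕ} (ψ : Fin L → K → ℂ) (f : K → ℂ) (i : Fin L × ℤ × ℕ) : ℂ :=
  ∫ x, f x * conj (E.waveletSystem ψ i x) ∂μ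

/-- The wavelet system generated by `ψ` is a wavelet frame for `L²(K)` with bounds `A`, `B`. -/
def IsWaveletFrame {L : ℕ} (A B : ℝ) (ψ : Fin L → K → ℂ) : Prop :=
  0 < A ∧ 0 < B ∧ (∀ ℓ, MemLp (ψ ℓ) 2 μ) ∧
    ∀ f : K → ℂ, MemLp f 2 μ →
      Summable (fun i => ‖E.waveletCoeff μ ψ f i‖ ^ 2) ∧
      A * ∫ x, ‖f x‖ ^ 2 ∂μ ≤ ∑' i, ‖E.waveletCoeff μ ψ f i‖ ^ 2 ∧
      ∑' i, ‖E.waveletCoeff μ ψ f i‖ ^ 2 ≤ B * ∫ x, ‖f x‖ ^ 2 ∂μ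

/-- A Parseval wavelet frame: both frame bounds are `1`. -/
def IsParsevalWaveletFrame {L : ℕ} (ψ : Fin L → K → ℂ) : Prop :=
  E.IsWaveletFrame μ 1 1 ψ

/-- The wavelet systems generated by `ψ` and `φ` are orthogonal:
`∑ ⟨f, ψ_{ℓ,j,k}⟩ φ_{ℓ,j,k} = 0` unconditionally in `L²(K)` for every `f ∈ L²(K)`. -/
def AreOrthogonal {L : ℕ} (ψ φ : Fin L → K → ℂ) : Prop :=
  ∀ f : K → ℂ, MemLp f 2 μ →
    Tendsto (fun s : Finset (Fin L × ℤ × ℕ) => eLpNorm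
      (fun x => ∑ i ∈ s, E.waveletCoeff μ ψ f i * E.waveletSystem φ i x) 2 μ)
      atTop (𝓝 0)

end LocalFieldData

/-- The two-column matrix with rows `(m_ℓ(ξ), m_ℓ(ξ + η))`. -/
def maskMatrix {K ι : Type*} [Add K] (m : ι → K → ℂ) (η ξ : K) : Matrix ι (Fin 2) ℂ :=
  Matrix.of fun ℓ => ![m ℓ ξ, m ℓ (ξ + η)]

/-!
The proof transports both wavelet systems to the Fourier side and reduces them, scale by scale, to
pointwise identities between the masks.

Write `𝔇` for the unit ball and `Λ = {u(k)}`. The recursion `u(q n + r) = u(r) + 𝔭⁻¹ u(n)` shows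
that `Λ` is a system of representatives of `K / 𝔇`, that `χ(λ λ') = 1` on `Λ`, and that the points
`𝔭 u(r)`, `r < q`, form the coefficient field, hence represent `𝔇 / 𝔭 𝔇`. The characters
`χ(u(k) y)` form a Hilbert basis of `L²(𝔇)` (`hasSum_parseval`; completeness is Stone-Weierstrass).
For a function supported in `𝔇` the Fourier integral is constant on the cosets of `𝔇`, with the
Fourier coefficients as values, so Parseval on `𝔇` and a dilation give the Plancherel theorem
(`IsFourierTransform.eLpNorm_eq`) and, by polarization, Parseval's relation on `K`.

For a test function `f` (bounded support in time and frequency) put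
`[F, H](ξ) = ∑_{λ ∈ Λ} F(ξ + λ) conj (H(ξ + λ))`, where `F` is the transform of `f`. The inner
products of `f` with the translates `h(x - u(k))` are the Fourier coefficients of `[F, H]` on `𝔇`
(`IsTest.hasSum_translates`). If `H(ξ) = m(𝔭 ξ) Φ(𝔭 ξ)` with a `Λ`-periodic `m`, then
`[F, H](ξ)` is, up to the factor `q^{-1/2}`, the sum over `r < q` of
`conj (m(𝔭 ξ + 𝔭 u(r))) A(𝔭 ξ + 𝔭 u(r))`, with `A` the bracket product of `Φ` and the dilate of `F`
(`bracket_refinement`). The matrix equations say that the columns `(m_ℓ(ξ + 𝔭 u(r)))_ℓ` are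
orthonormal. Summing over `ℓ` therefore gives `P_j + ∑_ℓ Q_{ℓ,j} = P_{j+1}`, where `P_j` and
`Q_{ℓ,j}` are the energies of the coefficients of `f` with respect to `φ` and `ψ_ℓ` at scale `j`
(`IsTest.sum_integral_bracket`). The energies `P_j` tend to `0` as `j → -∞`, and to `‖f‖²` as
`j → ∞`: there `[F, Φ]` has a single term and `|Φ| ≤ 1`, `|Φ(𝔭ʲ ξ)| → 1`. Telescoping is
Parseval's identity for `f`. The same computation with the orthogonality of the wavelet columns of
`m` and `m'` shows that the mixed sums vanish at each scale (`IsTest.tsum_mixed_eq_zero`).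

Test functions are dense (`dense_testSubmodule`), so both analysis operators are isometries of
`L²(K)` into `ℓ²`, and the mixed frame operator, which is the adjoint of one composed with the
other, is zero.
-/

open MeasureTheory Filter Topology Metric
open scoped ComplexConjugate Matrix ENNReal NNReal

set_option linter.unusedSectionVars false

namespace LocalFieldData

/-! ### Arithmetic of the sequence `u` -/

section Algebra

variable {K : Type*} [NontriviallyNormedField K] {p c : ℕ} (E : LocalFieldData K p c)

lemma prime_ne_zero : E.𝔭 ≠ 0 := by
  intro h
  obtain ⟨x, hx0, hx1⟩ := NormedField.exists_norm_lt_one K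
  have := E.norm_le_norm_prime x hx1
  rw [h, norm_zero] at this
  linarith

lemma norm_prime_pos : 0 < ‖E.𝔭‖ := norm_pos_iff.2 E.prime_ne_zero

/-- The residue degree is positive: for `c = 0` the coefficient field would be `{0}`. -/
lemma c_pos (E : LocalFieldData K p c) : 0 < c := by
  rcases Nat.eq_zero_or_pos c with rfl | h
  · exfalso
    obtain ⟨a, -, ha⟩ := E.span_ζ.surjOn E.F.one_mem
    simp at ha
  · exact h


lemma uDigit_zero : E.uDigit 0 = 0 := by simp [uDigit]

lemma prime_mul_uDigit (b : ℕ) :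
    E.𝔭 * E.uDigit b = ∑ i : Fin c, ((b / p ^ (i : ℕ) % p : ℕ) : K) * E.ζ i := by
  rw [uDigit, mul_comm, mul_assoc, inv_mul_cancel₀ E.prime_ne_zero, mul_one]

lemma norm_eq_one_of_mem {a : K} (ha : a ∈ E.F) (h0 : a ≠ 0) : ‖a‖ = 1 := by
  have hfin : (E.F : Set K).Finite := by
    rw [← E.span_ζ.image_eq]; exact Set.Finite.image _ Set.finite_univ
  have : Finite E.F := hfin.to_subtype
  obtain ⟨n, hn, h⟩ := isOfFinOrder_iff_pow_eq_one.1
    (isOfFinOrder_of_finite (Units.mk0 (⟨a, ha⟩ : E.F) (by simpa [Subtype.ext_iff] using h0)))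
  have h2 : a ^ n = 1 := by
    have := congrArg (fun z : (E.F)ˣ => ((z : E.F) : K)) h
    simpa using this
  have h3 : ‖a‖ ^ n = 1 := by rw [← norm_pow, h2, norm_one]
  exact (pow_eq_one_iff_of_nonneg (norm_nonneg _) hn.ne').1 h3

lemma norm_coeff_le {a : K} (ha : a ∈ E.F) : ‖a‖ ≤ 1 := by
  by_cases h : a = 0
  · simp [h]
  · exact (E.norm_eq_one_of_mem ha h).le

lemma eq_of_norm_sub_lt {a b : K} (ha : a ∈ E.F) (hb : b ∈ E.F) (h : ‖a - b‖ < 1) : a = b := by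
  by_contra hab
  exact h.ne (E.norm_eq_one_of_mem (E.F.sub_mem ha hb) (sub_ne_zero.2 hab))

lemma exists_pow_mul_norm_le (R : ℝ) : ∃ N : ℕ, ∀ x : K, ‖x‖ ≤ R → ‖E.𝔭‖ ^ N * ‖x‖ ≤ 1 := by
  have h := (tendsto_pow_atTop_nhds_zero_of_lt_one E.norm_prime_pos.le
    E.norm_prime_lt_one).mul_const (max R 0)
  rw [zero_mul] at h
  obtain ⟨N, hN⟩ := (h.eventually (gt_mem_nhds one_pos)).exists
  refine ⟨N, fun x hx => le_trans ?_ hN.le⟩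
  have := E.norm_prime_pos
  gcongr
  exact hx.trans (le_max_left _ _)

variable [hp : Fact p.Prime]

lemma one_lt_q (E : LocalFieldData K p c) : 1 < p ^ c := Nat.one_lt_pow E.c_pos.ne' hp.out.one_lt

lemma q_pos (_E : LocalFieldData K p c) : 0 < p ^ c := pow_pos hp.out.pos _

lemma q_real_pos (_E : LocalFieldData K p c) : (0 : ℝ) < (p : ℝ) ^ c := by
  have := hp.out.pos
  positivity

/-- The digits `b / p ^ i % p`, as a function into `Fin p`. -/
lemma prime_mul_uDigit_eq (b : ℕ) : ∃ a : Fin c → Fin p,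
    (∀ i, (a i : ℕ) = b / p ^ (i : ℕ) % p) ∧
      E.𝔭 * E.uDigit b = (fun a : Fin c → Fin p => ∑ i, ((a i : ℕ) : K) * E.ζ i) a :=
  ⟨fun i => ⟨b / p ^ (i : ℕ) % p, Nat.mod_lt _ hp.out.pos⟩, fun _ => rfl, E.prime_mul_uDigit b⟩

lemma prime_mul_uDigit_mem (b : ℕ) : E.𝔭 * E.uDigit b ∈ E.F := by
  obtain ⟨a, -, ha⟩ := E.prime_mul_uDigit_eq b
  rw [ha]
  exact E.span_ζ.mapsTo (Set.mem_univ a)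

lemma exists_uDigit {a : K} (ha : a ∈ E.F) : ∃ r < p ^ c, E.𝔭 * E.uDigit r = a := by
  obtain ⟨f, -, rfl⟩ := E.span_ζ.surjOn ha
  refine ⟨finFunctionFinEquiv f, (finFunctionFinEquiv f).2, ?_⟩
  rw [prime_mul_uDigit]
  refine Finset.sum_congr rfl fun i _ => ?_
  have : ((finFunctionFinEquiv.symm (finFunctionFinEquiv f)) i : ℕ) =
    (finFunctionFinEquiv f : ℕ) / p ^ (i : ℕ) % p := rfl
  rw [← this, Equiv.symm_apply_apply]

lemma uDigit_injOn {r s : ℕ} (hr : r < p ^ c) (hs : s < p ^ c)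
    (h : E.𝔭 * E.uDigit r = E.𝔭 * E.uDigit s) : r = s := by
  obtain ⟨a, ha, ha'⟩ := E.prime_mul_uDigit_eq r
  obtain ⟨b, hb, hb'⟩ := E.prime_mul_uDigit_eq s
  have hab : a = b := E.span_ζ.injOn (Set.mem_univ _) (Set.mem_univ _) (by
    rw [ha', hb'] at h; exact h)
  have key : (finFunctionFinEquiv.symm (⟨r, hr⟩ : Fin (p ^ c)) : Fin c → Fin p) =
      finFunctionFinEquiv.symm (⟨s, hs⟩ : Fin (p ^ c)) := by
    funext i
    apply Fin.ext
    change r / p ^ (i : ℕ) % p = s / p ^ (i : ℕ) % p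
    rw [← ha, ← hb, hab]
  simpa using finFunctionFinEquiv.symm.injective key

lemma u_eq_sum {n M : ℕ} (h : n < M) :
    E.u n = ∑ s ∈ Finset.range M, E.uDigit (n / (p ^ c) ^ s % p ^ c) * E.𝔭⁻¹ ^ s := by
  rw [u]
  refine Finset.sum_subset (fun s hs => ?_) fun s _ hs => ?_
  · simp only [Finset.mem_range] at hs ⊢; omega
  · have hs' : n < s := by simpa [Nat.lt_succ_iff] using hs
    rw [Nat.div_eq_of_lt (hs'.trans (Nat.lt_pow_self E.one_lt_q)), Nat.zero_mod, uDigit_zero,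
      zero_mul]

lemma u_of_lt {r : ℕ} (hr : r < p ^ c) : E.u r = E.uDigit r := by
  rw [u, Finset.sum_range_succ', Finset.sum_eq_zero]
  · simp [Nat.mod_eq_of_lt hr]
  · intro s _
    rw [Nat.div_eq_of_lt, Nat.zero_mod, uDigit_zero, zero_mul]
    exact hr.trans_le (Nat.le_self_pow (by simp) _)

lemma u_zero : E.u 0 = 0 := by rw [E.u_of_lt E.q_pos, uDigit_zero]

/-- The recursion behind all properties of the sequence `u`. -/
lemma u_mul_add (n : ℕ) {r : ℕ} (hr : r < p ^ c) :
    E.u (p ^ c * n + r) = E.u r + E.𝔭⁻¹ * E.u n := by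
  have hn : n ≤ p ^ c * n := Nat.le_mul_of_pos_left n E.q_pos
  rw [E.u_eq_sum (show p ^ c * n + r < (p ^ c * n + r + 1) + 1 by omega), Finset.sum_range_succ',
    E.u_eq_sum (show n < p ^ c * n + r + 1 by omega), E.u_of_lt hr, add_comm, Finset.mul_sum]
  congr 1
  · simp [Nat.mod_eq_of_lt hr]
  · refine Finset.sum_congr rfl fun s _ => ?_
    rw [pow_succ' (p ^ c), ← Nat.div_div_eq_div_mul, Nat.mul_add_div E.q_pos,
      Nat.div_eq_of_lt hr, add_zero, pow_succ]
    ring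

lemma prime_mul_u_mem {r : ℕ} (hr : r < p ^ c) : E.𝔭 * E.u r ∈ E.F := by
  rw [E.u_of_lt hr]; exact E.prime_mul_uDigit_mem r

lemma exists_prime_mul_u {a : K} (ha : a ∈ E.F) : ∃ r < p ^ c, E.𝔭 * E.u r = a := by
  obtain ⟨r, hr, h⟩ := E.exists_uDigit ha
  exact ⟨r, hr, by rw [E.u_of_lt hr, h]⟩

/-- Strong induction along base-`q` digits. -/
lemma digit_induction (E : LocalFieldData K p c) {P : ℕ → Prop} (h0 : P 0)
    (h : ∀ n r, r < p ^ c → P n → P (p ^ c * n + r)) (n : ℕ) : P n := by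
  induction n using Nat.strong_induction_on with
  | _ n ih =>
    rcases Nat.eq_zero_or_pos n with rfl | hn
    · exact h0
    · have := h (n / p ^ c) (n % p ^ c) (Nat.mod_lt _ E.q_pos)
        (ih _ (Nat.div_lt_self hn E.one_lt_q))
      rwa [Nat.div_add_mod] at this

/-! ### The character -/

lemma χ_coeff (j : ℤ) (hj : j ≠ 1) {a : K} (ha : a ∈ E.F) : E.χ (a * E.𝔭 ^ (-j)) = 1 := by
  obtain ⟨f, -, rfl⟩ := E.span_ζ.surjOn ha
  have : ∀ i : Fin c, E.χ (E.ζ i * E.𝔭 ^ (-j)) = 1 := fun i => by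
    apply Subtype.ext
    have := E.χ_apply i j
    rw [if_neg (by tauto)] at this
    simpa using this
  have h2 : ∀ s : Finset (Fin c), E.χ (∑ i ∈ s, ((f i : ℕ) : K) * E.ζ i * E.𝔭 ^ (-j)) = 1 := by
    intro s
    induction s using Finset.induction_on with
    | empty => simp
    | insert i s hi ih =>
      rw [Finset.sum_insert hi, AddChar.map_add_eq_mul, ih, mul_one, mul_assoc, ← nsmul_eq_mul,
        AddChar.map_nsmul_eq_pow, this, one_pow]
  rw [Finset.sum_mul]
  exact h2 _

lemma χ_inv_prime_ne_one : E.χ (E.𝔭⁻¹) ≠ 1 := by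
  intro h
  have hz := E.χ_apply ⟨0, E.c_pos⟩ 1
  rw [E.ζ_zero _ rfl, one_mul, zpow_neg_one, h] at hz
  simp only [Circle.coe_one, and_self, if_true] at hz
  exact (Complex.isPrimitiveRoot_exp p hp.out.ne_zero).ne_one hp.out.one_lt hz.symm

lemma χ_coeff_mul_u {a : K} (ha : a ∈ E.F) (n : ℕ) :
    ∀ j : ℕ, 1 ≤ j → E.χ (a * E.𝔭⁻¹ ^ j * E.u n) = 1 := by
  revert n a
  suffices H : ∀ n, ∀ a ∈ E.F, ∀ j : ℕ, 1 ≤ j → E.χ (a * E.𝔭⁻¹ ^ j * E.u n) = 1 from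
    fun {a} ha n => H n a ha
  refine E.digit_induction (by simp [E.u_zero]) fun n r hr ih a ha j hj => ?_
  rw [E.u_mul_add n hr, mul_add, AddChar.map_add_eq_mul]
  have e1 : a * E.𝔭⁻¹ ^ j * E.u r = (a * (E.𝔭 * E.u r)) * E.𝔭 ^ (-((j : ℤ) + 1)) := by
    rw [neg_add, ← sub_eq_add_neg, zpow_sub_one₀ E.prime_ne_zero, zpow_neg, zpow_natCast, inv_pow]
    field_simp [E.prime_ne_zero]
  rw [e1, E.χ_coeff _ (by omega) (E.F.mul_mem ha (E.prime_mul_u_mem hr)), one_mul,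
    ← ih a ha (j + 1) (by omega), pow_succ]
  congr 1; ring

/-- The lattice `{u(k)}` is isotropic for the pairing `χ(x y)`. -/
lemma χ_u_mul_u (m n : ℕ) : E.χ (E.u m * E.u n) = 1 := by
  suffices H : ∀ m, ∀ j : ℕ, E.χ (E.𝔭⁻¹ ^ j * E.u m * E.u n) = 1 by simpa using H m 0
  refine E.digit_induction (by simp [E.u_zero]) fun m r hr ih j => ?_
  rw [E.u_mul_add m hr, mul_add, add_mul, AddChar.map_add_eq_mul]
  have e1 : E.𝔭⁻¹ ^ j * E.u r * E.u n = (E.𝔭 * E.u r) * E.𝔭⁻¹ ^ (j + 1) * E.u n := by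
    rw [pow_succ]; field_simp [E.prime_ne_zero]
  rw [e1, E.χ_coeff_mul_u (E.prime_mul_u_mem hr) n (j + 1) (by omega), one_mul,
    ← ih (j + 1), pow_succ]
  congr 1; ring

/-! ### Coset decompositions -/

lemma norm_prime_mul_u_le {r : ℕ} (hr : r < p ^ c) : ‖E.𝔭 * E.u r‖ ≤ 1 :=
  E.norm_coeff_le (E.prime_mul_u_mem hr)

/-- Every point of norm at most `‖𝔭‖ ^ (-N)` is congruent modulo `𝔇` to some `u(n)` with
`n < q ^ N`. -/
lemma exists_u_of_norm_le (N : ℕ) : ∀ x : K, ‖E.𝔭‖ ^ N * ‖x‖ ≤ 1 →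
    ∃ n < (p ^ c) ^ N, ‖x - E.u n‖ ≤ 1 := by
  induction N with
  | zero => intro x hx; exact ⟨0, by simp, by simpa [E.u_zero] using hx⟩
  | succ N ih =>
    intro x hx
    obtain ⟨n, hn, hy⟩ := ih (E.𝔭 * x) (by rw [norm_mul, ← mul_assoc, ← pow_succ]; exact hx)
    obtain ⟨a, ha, hya⟩ := E.residue _ hy
    obtain ⟨r, hr, rfl⟩ := E.exists_prime_mul_u ha
    refine ⟨p ^ c * n + r, ?_, ?_⟩
    · calc p ^ c * n + r < p ^ c * n + p ^ c := by omega
        _ = p ^ c * (n + 1) := by ring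
        _ ≤ p ^ c * (p ^ c) ^ N := Nat.mul_le_mul_left _ hn
        _ = (p ^ c) ^ (N + 1) := by ring
    · have e : x - E.u (p ^ c * n + r) = E.𝔭⁻¹ * (E.𝔭 * x - E.u n - E.𝔭 * E.u r) := by
        rw [E.u_mul_add n hr]; field_simp [E.prime_ne_zero]; ring
      rw [e, norm_mul, norm_inv, inv_mul_le_iff₀ E.norm_prime_pos, mul_one]
      exact E.norm_le_norm_prime _ hya

lemma exists_norm_sub_u_le (x : K) : ∃ n, ‖x - E.u n‖ ≤ 1 := by
  obtain ⟨N, hN⟩ := E.exists_pow_mul_norm_le ‖x‖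
  obtain ⟨n, -, h⟩ := E.exists_u_of_norm_le N x (hN x le_rfl)
  exact ⟨n, h⟩

lemma norm_add_le_of_le [IsUltrametricDist K] {x y : K} {r : ℝ} (hx : ‖x‖ ≤ r) (hy : ‖y‖ ≤ r) :
    ‖x + y‖ ≤ r :=
  (IsUltrametricDist.norm_add_le_max x y).trans (max_le hx hy)

lemma norm_sub_le_of_le [IsUltrametricDist K] {x y : K} {r : ℝ} (hx : ‖x‖ ≤ r) (hy : ‖y‖ ≤ r) :
    ‖x - y‖ ≤ r := by
  rw [sub_eq_add_neg]
  exact norm_add_le_of_le hx (by rwa [norm_neg])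

lemma u_inj_mod [IsUltrametricDist K] : ∀ n m : ℕ, ‖E.u n - E.u m‖ ≤ 1 → n = m := by
  intro n
  induction n using Nat.strong_induction_on with
  | _ n ih =>
    intro m
    induction m using Nat.strong_induction_on with
    | _ m ihm =>
      intro h
      have hq := E.one_lt_q
      set n' := n / p ^ c
      set m' := m / p ^ c
      have hr := Nat.mod_lt n E.q_pos
      have hs := Nat.mod_lt m E.q_pos
      have e1 := E.u_mul_add n' hr
      have e2 := E.u_mul_add m' hs
      rw [Nat.div_add_mod] at e1 e2
      have h1 : ‖E.𝔭 * E.u (n % p ^ c) - E.𝔭 * E.u (m % p ^ c) + (E.u n' - E.u m')‖ ≤ ‖E.𝔭‖ := by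
        have : E.𝔭 * E.u (n % p ^ c) - E.𝔭 * E.u (m % p ^ c) + (E.u n' - E.u m') =
            E.𝔭 * (E.u n - E.u m) := by
          rw [e1, e2]; field_simp [E.prime_ne_zero]; ring
        rw [this, norm_mul]
        exact mul_le_of_le_one_right (norm_nonneg _) h
      have h2 : ‖E.u n' - E.u m'‖ ≤ 1 := by
        have := norm_sub_le_of_le (h1.trans E.norm_prime_lt_one.le)
          (norm_sub_le_of_le (E.norm_prime_mul_u_le hr) (E.norm_prime_mul_u_le hs))
        simpa using this
      have h3 : n' = m' := by
        rcases Nat.eq_zero_or_pos n with hn | hn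
        · rcases Nat.eq_zero_or_pos m with hm | hm
          · simp [n', m', hn, hm]
          · have : n' = n := by simp [n', hn]
            rw [this] at h2
            rw [this]
            exact ihm m' (Nat.div_lt_self hm hq) h2
        · exact ih n' (Nat.div_lt_self hn hq) m' h2
      rw [h3, sub_self, add_zero] at h1
      have h4 := E.eq_of_norm_sub_lt (E.prime_mul_u_mem hr) (E.prime_mul_u_mem hs)
        (h1.trans_lt E.norm_prime_lt_one)
      rw [E.u_of_lt hr, E.u_of_lt hs] at h4
      have h5 := E.uDigit_injOn hr hs h4
      rw [← Nat.div_add_mod n (p ^ c), ← Nat.div_add_mod m (p ^ c), h5]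
      change p ^ c * n' + _ = p ^ c * m' + _
      rw [h3]

/-- Only finitely many `u(n)` lie in a given ball. -/
lemma exists_forall_norm_u_gt [IsUltrametricDist K] (R : ℝ) : ∃ N, ∀ n, N ≤ n → R < ‖E.u n‖ := by
  obtain ⟨N, hN⟩ := E.exists_pow_mul_norm_le R
  refine ⟨(p ^ c) ^ N, fun n hn => ?_⟩
  by_contra! h
  obtain ⟨m, hm, h'⟩ := E.exists_u_of_norm_le N (E.u n) (hN _ h)
  have := E.u_inj_mod n m h'
  omega

lemma χ_of_norm_le_one {x : K} (hx : ‖x‖ ≤ 1) : E.χ x = 1 := by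
  -- `x` is a finite sum of terms `a_s 𝔭 ^ s`, on which `χ` is trivial, up to `𝔭 ^ N 𝔇`
  have key : ∀ N : ℕ, ∃ y : K, E.χ y = 1 ∧ ‖x - y‖ ≤ ‖E.𝔭‖ ^ N := by
    intro N
    induction N with
    | zero => exact ⟨0, by simp, by simpa using hx⟩
    | succ N ih =>
      obtain ⟨y, hy, hxy⟩ := ih
      obtain ⟨a, ha, h⟩ := E.residue ((E.𝔭 ^ N)⁻¹ * (x - y)) (by
        rw [norm_mul, norm_inv, norm_pow, inv_mul_le_iff₀ (pow_pos E.norm_prime_pos _), mul_one]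
        exact hxy)
      refine ⟨y + a * E.𝔭 ^ N, ?_, ?_⟩
      · rw [AddChar.map_add_eq_mul, hy, one_mul]
        have := E.χ_coeff (-(N : ℤ)) (by omega) ha
        rwa [neg_neg, zpow_natCast] at this
      · have e : x - (y + a * E.𝔭 ^ N) = E.𝔭 ^ N * ((E.𝔭 ^ N)⁻¹ * (x - y) - a) := by
          field_simp [E.prime_ne_zero]; ring
        rw [e, norm_mul, norm_pow, pow_succ]
        gcongr
        exact E.norm_le_norm_prime _ h
  choose y hy hxy using key
  have hlim : Tendsto y atTop (𝓝 x) := by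
    rw [tendsto_iff_norm_sub_tendsto_zero]
    refine squeeze_zero (fun _ => norm_nonneg _) (fun n => ?_)
      (tendsto_pow_atTop_nhds_zero_of_lt_one E.norm_prime_pos.le E.norm_prime_lt_one)
    rw [norm_sub_rev]; exact hxy n
  have h1 := (E.continuous_χ.tendsto x).comp hlim
  have h2 : E.χ ∘ y = fun _ => 1 := funext hy
  rw [h2] at h1
  exact tendsto_nhds_unique h1 tendsto_const_nhds

/-- A character `y ↦ χ(x y)` with `x ∉ 𝔇` is nontrivial on `𝔇`. -/
lemma exists_χ_mul_ne_one {x : K} (hx : 1 < ‖x‖) : ∃ y : K, ‖y‖ ≤ 1 ∧ E.χ (x * y) ≠ 1 := by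
  have hx0 : x ≠ 0 := norm_pos_iff.1 (by linarith)
  refine ⟨x⁻¹ * E.𝔭⁻¹, ?_, by rw [mul_inv_cancel_left₀ hx0]; exact E.χ_inv_prime_ne_one⟩
  have := E.norm_le_norm_prime x⁻¹ (by rw [norm_inv]; exact inv_lt_one_of_one_lt₀ hx)
  rw [norm_mul, norm_inv E.𝔭, ← div_eq_mul_inv, div_le_one E.norm_prime_pos]
  exact this

lemma χ_add_right {x y : K} (hy : ‖y‖ ≤ 1) : E.χ (x + y) = E.χ x := by
  rw [AddChar.map_add_eq_mul, E.χ_of_norm_le_one hy, mul_one]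

lemma χ_u_mul_add_u (k l : ℕ) (x : K) : E.χ (E.u k * (x + E.u l)) = E.χ (E.u k * x) := by
  rw [mul_add, AddChar.map_add_eq_mul, E.χ_u_mul_u, mul_one]

/-- The points `𝔭 u(r)`, `r < q`, form a group. -/
lemma exists_prime_mul_u_sub {r s : ℕ} (hr : r < p ^ c) (hs : s < p ^ c) (hrs : r ≠ s) :
    ∃ k, 1 ≤ k ∧ k < p ^ c ∧ E.𝔭 * E.u s = E.𝔭 * E.u r + E.𝔭 * E.u k := by
  obtain ⟨k, hk, h⟩ := E.exists_prime_mul_u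
    (E.F.sub_mem (E.prime_mul_u_mem hs) (E.prime_mul_u_mem hr))
  refine ⟨k, ?_, hk, by rw [h]; ring⟩
  rcases Nat.eq_zero_or_pos k with rfl | hk0
  · rw [E.u_zero, mul_zero, eq_comm, sub_eq_zero, E.u_of_lt hr, E.u_of_lt hs] at h
    exact absurd (E.uDigit_injOn hs hr h).symm hrs
  · exact hk0

end Algebra

/-! ### Haar measure -/

section HaarMeasure

variable {K : Type*} [NontriviallyNormedField K] {p c : ℕ} (E : LocalFieldData K p c)
  [hp : Fact p.Prime] [IsUltrametricDist K] [ProperSpace K] [MeasurableSpace K] [BorelSpace K]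
  (μ : Measure K) [μ.IsAddHaarMeasure]

lemma preimage_add_closedBall {y : K} {r : ℝ} (hy : ‖y‖ ≤ r) :
    (fun x : K => x + y) ⁻¹' closedBall 0 r = closedBall 0 r := by
  ext x
  simp only [Set.mem_preimage, mem_closedBall_zero_iff]
  refine ⟨fun h => ?_, fun h => norm_add_le_of_le h hy⟩
  simpa using norm_sub_le_of_le h hy

lemma preimage_add_closedBall_self (y : K) (r : ℝ) :
    (fun x : K => x + y) ⁻¹' closedBall y r = closedBall 0 r := by
  ext x
  simp [dist_eq_norm]

lemma pairwise_disjoint_closedBall_u :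
    Pairwise (Function.onFun Disjoint fun k : ℕ => closedBall (E.u k) 1) := by
  intro k l hkl
  rw [Function.onFun, Set.disjoint_left]
  intro x hx hx'
  rw [mem_closedBall, dist_eq_norm] at hx hx'
  refine hkl (E.u_inj_mod k l ?_)
  simpa using norm_sub_le_of_le hx' hx

lemma iUnion_closedBall_u : ⋃ k : ℕ, closedBall (E.u k) 1 = Set.univ := by
  refine Set.eq_univ_of_forall fun x => Set.mem_iUnion.2 ?_
  obtain ⟨n, hn⟩ := E.exists_norm_sub_u_le x
  exact ⟨n, by rwa [mem_closedBall, dist_eq_norm]⟩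

lemma biUnion_closedBall_u :
    ⋃ r ∈ Finset.range (p ^ c), closedBall (E.u r) 1 = closedBall (0 : K) ‖E.𝔭‖⁻¹ := by
  have hpos := E.norm_prime_pos
  ext x
  simp only [Set.mem_iUnion, Finset.mem_range, mem_closedBall, dist_eq_norm, sub_zero]
  constructor
  · rintro ⟨r, hr, h⟩
    have h1 : ‖E.u r‖ ≤ ‖E.𝔭‖⁻¹ := by
      have := E.norm_prime_mul_u_le hr
      rw [norm_mul] at this
      rwa [← one_div, le_div_iff₀' hpos]
    have h2 : (1 : ℝ) ≤ ‖E.𝔭‖⁻¹ := (one_le_inv₀ hpos).2 E.norm_prime_lt_one.le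
    simpa using norm_add_le_of_le (h.trans h2) h1
  · intro h
    obtain ⟨r, hr, h'⟩ := E.exists_u_of_norm_le 1 x (by
      rw [pow_one]; rwa [← one_div, le_div_iff₀' hpos] at h)
    exact ⟨r, by simpa using hr, h'⟩

lemma setLIntegral_closedBall_add (h : K → ℝ≥0∞) (y : K) (r : ℝ) :
    ∫⁻ x in closedBall y r, h x ∂μ = ∫⁻ x in closedBall 0 r, h (x + y) ∂μ := by
  rw [← (measurePreserving_add_right μ y).setLIntegral_comp_preimage_emb
    (MeasurableEquiv.addRight y).measurableEmbedding h, preimage_add_closedBall_self]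

lemma setIntegral_closedBall_add (h : K → ℂ) (y : K) (r : ℝ) :
    ∫ x in closedBall y r, h x ∂μ = ∫ x in closedBall 0 r, h (x + y) ∂μ := by
  rw [← (measurePreserving_add_right μ y).setIntegral_preimage_emb
    (MeasurableEquiv.addRight y).measurableEmbedding h, preimage_add_closedBall_self]

lemma setIntegral_closedBall_zero_add (h : K → ℂ) {y : K} {r : ℝ} (hy : ‖y‖ ≤ r) :
    ∫ x in closedBall 0 r, h (x + y) ∂μ = ∫ x in closedBall 0 r, h x ∂μ := by
  rw [← (measurePreserving_add_right μ y).setIntegral_preimage_emb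
    (MeasurableEquiv.addRight y).measurableEmbedding h, preimage_add_closedBall hy]

/-- Periodization over the lattice `{u(k)}`. -/
lemma lintegral_eq_tsum (h : K → ℝ≥0∞) :
    ∫⁻ x, h x ∂μ = ∑' k, ∫⁻ x in closedBall 0 1, h (x + E.u k) ∂μ := by
  rw [← setLIntegral_univ, ← E.iUnion_closedBall_u,
    lintegral_iUnion (fun _ => measurableSet_closedBall) E.pairwise_disjoint_closedBall_u]
  exact tsum_congr fun k => setLIntegral_closedBall_add μ h _ _

/-- Periodization over the lattice `{-u(k)}`. -/
lemma lintegral_eq_tsum_sub (h : K → ℝ≥0∞) :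
    ∫⁻ x, h x ∂μ = ∑' k, ∫⁻ x in closedBall 0 1, h (x - E.u k) ∂μ := by
  rw [← lintegral_neg_eq_self (μ := μ) h, E.lintegral_eq_tsum μ]
  refine tsum_congr fun k => ?_
  have hneg : (Neg.neg : K → K) ⁻¹' closedBall 0 1 = closedBall 0 1 := by ext x; simp
  rw [← (Measure.measurePreserving_neg μ).setLIntegral_comp_preimage_emb
    (MeasurableEquiv.neg K).measurableEmbedding (fun x => h (x - E.u k)), hneg]
  refine lintegral_congr fun x => ?_
  rw [neg_add, sub_eq_add_neg]

/-- Periodization of a boundedly supported function. -/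
lemma exists_integral_eq_sum (R : ℝ) : ∃ N₀ : ℕ, ∀ N, N₀ ≤ N → ∀ h : K → ℂ, Integrable h μ →
    (∀ x, R < ‖x‖ → h x = 0) →
      ∫ x, h x ∂μ = ∑ k ∈ Finset.range N, ∫ x in closedBall 0 1, h (x + E.u k) ∂μ := by
  obtain ⟨N₀, hN₀⟩ := E.exists_forall_norm_u_gt (max R 1)
  refine ⟨N₀, fun N hN h hi hR => ?_⟩
  have hs := hasSum_integral_iUnion (fun k => (measurableSet_closedBall (x := E.u k) (ε := 1)))
    E.pairwise_disjoint_closedBall_u (f := h) (μ := μ) hi.integrableOn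
  rw [E.iUnion_closedBall_u, setIntegral_univ] at hs
  refine hs.unique ?_
  simp_rw [setIntegral_closedBall_add μ h]
  refine hasSum_sum_of_ne_finset_zero fun k hk => ?_
  refine setIntegral_eq_zero_of_forall_eq_zero fun x hx => hR _ ?_
  have hk' := hN₀ k (hN.trans (by simpa using hk))
  by_contra! hle
  rw [mem_closedBall_zero_iff] at hx
  have := norm_sub_le_of_le (hle.trans (le_max_left R 1)) (hx.trans (le_max_right R 1))
  rw [add_sub_cancel_left] at this
  exact hk'.not_ge this

variable {μ} in
lemma measure_closedBall_inv_prime (hμ : μ (closedBall (0 : K) 1) = 1) :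
    μ (closedBall (0 : K) ‖E.𝔭‖⁻¹) = (p ^ c : ℕ) := by
  rw [← E.biUnion_closedBall_u, measure_biUnion_finset
    (fun i _ j _ hij => E.pairwise_disjoint_closedBall_u hij) fun _ _ => measurableSet_closedBall]
  have : ∀ r : ℕ, μ (closedBall (E.u r) 1) = 1 := fun r => by
    rw [← setLIntegral_one, setLIntegral_closedBall_add, setLIntegral_one, hμ]
  simp [this]

variable {μ} in
lemma map_prime_mul (hμ : μ (closedBall (0 : K) 1) = 1) :
    μ.map (E.𝔭 * ·) = ((p : ℝ≥0) ^ c) • μ := by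
  have hH : (μ.map (E.𝔭 * ·)).IsAddHaarMeasure :=
    AddEquiv.isAddHaarMeasure_map μ
      ({ toFun := (E.𝔭 * ·), invFun := (E.𝔭⁻¹ * ·), left_inv := fun x => by
           simp [E.prime_ne_zero], right_inv := fun x => by simp [E.prime_ne_zero],
         map_add' := mul_add _ } : K ≃+ K)
      (by simpa using continuous_const_mul E.𝔭) (continuous_const_mul E.𝔭⁻¹)
  have h := Measure.isAddLeftInvariant_eq_smul (μ.map (E.𝔭 * ·)) μ
  have h1 := congrArg (fun ν => ν (closedBall (0 : K) 1)) h
  have h2 : (E.𝔭 * ·) ⁻¹' closedBall (0 : K) 1 = closedBall (0 : K) ‖E.𝔭‖⁻¹ := by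
    ext x
    rw [Set.mem_preimage, mem_closedBall_zero_iff, mem_closedBall_zero_iff, norm_mul, ← one_div,
      le_div_iff₀' E.norm_prime_pos]
  simp only [Measure.smul_apply, hμ] at h1
  rw [Measure.map_apply (measurable_const_mul _) measurableSet_closedBall, h2,
    E.measure_closedBall_inv_prime hμ, ENNReal.smul_def, smul_eq_mul, mul_one] at h1
  rw [h]
  congr 1
  have h3 : ((p ^ c : ℕ) : ℝ≥0) = (μ.map (E.𝔭 * ·)).addHaarScalarFactor μ := by
    exact_mod_cast h1
  rw [← h3]; push_cast; rfl

variable {μ} in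
lemma map_zpow_mul (hμ : μ (closedBall (0 : K) 1) = 1) (n : ℤ) :
    μ.map (E.𝔭 ^ n * ·) = ((p : ℝ≥0) ^ c) ^ n • μ := by
  have hq : ((p : ℝ≥0) ^ c) ≠ 0 := by have := hp.out.ne_zero; positivity
  have hcomp : ∀ a b : K, μ.map (a * b * ·) = (μ.map (b * ·)).map (a * ·) := fun a b => by
    rw [Measure.map_map (measurable_const_mul a) (measurable_const_mul b)]
    congr 1; ext x; simp [mul_assoc]
  have h1 := E.map_prime_mul hμ
  have hinv : μ.map (E.𝔭⁻¹ * ·) = ((p : ℝ≥0) ^ c)⁻¹ • μ := by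
    have := hcomp E.𝔭⁻¹ E.𝔭
    rw [inv_mul_cancel₀ E.prime_ne_zero, h1, Measure.map_smul] at this
    simp only [one_mul, Measure.map_id'] at this
    conv_rhs => rw [this]
    rw [smul_smul, inv_mul_cancel₀ hq, one_smul]
  induction n using Int.induction_on with
  | zero => simp
  | succ n ih =>
    rw [zpow_add_one₀ E.prime_ne_zero, hcomp, h1, Measure.map_smul, ih, smul_smul,
      zpow_add_one₀ hq, mul_comm]
  | pred n ih =>
    rw [zpow_sub_one₀ E.prime_ne_zero, hcomp, hinv, Measure.map_smul, ih, smul_smul,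
      zpow_sub_one₀ hq, mul_comm]

variable {μ} in
lemma lintegral_zpow_mul (hμ : μ (closedBall (0 : K) 1) = 1) (n : ℤ) (h : K → ℝ≥0∞) :
    ∫⁻ x, h (E.𝔭 ^ n * x) ∂μ = (((p : ℝ≥0) ^ c) ^ n : ℝ≥0) * ∫⁻ x, h x ∂μ := by
  have := lintegral_map_equiv (μ := μ) h
    (MeasurableEquiv.mulLeft₀ (E.𝔭 ^ n) (zpow_ne_zero n E.prime_ne_zero))
  rw [MeasurableEquiv.coe_mulLeft₀, E.map_zpow_mul hμ, lintegral_smul_measure] at this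
  exact this.symm

variable {μ} in
lemma integral_zpow_mul (hμ : μ (closedBall (0 : K) 1) = 1) (n : ℤ) (h : K → ℂ) :
    ∫ x, h (E.𝔭 ^ n * x) ∂μ = ((p : ℂ) ^ c) ^ n * ∫ x, h x ∂μ := by
  have := integral_map_equiv (μ := μ)
    (MeasurableEquiv.mulLeft₀ (E.𝔭 ^ n) (zpow_ne_zero n E.prime_ne_zero)) h
  rw [MeasurableEquiv.coe_mulLeft₀, E.map_zpow_mul hμ, integral_smul_nnreal_measure] at this
  refine this.symm.trans ?_
  simp [NNReal.smul_def]

variable {μ} in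
lemma quasiMeasurePreserving_zpow_mul (hμ : μ (closedBall (0 : K) 1) = 1) (n : ℤ) :
    Measure.QuasiMeasurePreserving (E.𝔭 ^ n * ·) μ μ := by
  refine ⟨measurable_const_mul _, ?_⟩
  rw [E.map_zpow_mul hμ]
  exact Measure.smul_absolutelyContinuous

variable {μ} in
lemma integrableOn_comp_mul_prime (hμ : μ (closedBall (0 : K) 1) = 1) {h : K → ℂ}
    (hi : IntegrableOn h (closedBall 0 1) μ) :
    IntegrableOn (fun x => h (E.𝔭 * x)) (closedBall 0 ‖E.𝔭‖⁻¹) μ ∧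
      ∫ x in closedBall 0 ‖E.𝔭‖⁻¹, h (E.𝔭 * x) ∂μ =
        (p : ℂ) ^ c * ∫ x in closedBall 0 1, h x ∂μ := by
  have hmem : ∀ x : K, E.𝔭 * x ∈ closedBall (0 : K) 1 ↔ x ∈ closedBall (0 : K) ‖E.𝔭‖⁻¹ := by
    intro x
    rw [mem_closedBall_zero_iff, mem_closedBall_zero_iff, norm_mul, ← one_div,
      le_div_iff₀' E.norm_prime_pos]
  have hind : ∀ x : K, (closedBall (0 : K) ‖E.𝔭‖⁻¹).indicator (fun x => h (E.𝔭 * x)) x =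
      (closedBall (0 : K) 1).indicator h (E.𝔭 * x) := by
    intro x
    classical
    exact if_congr (hmem x).symm rfl rfl
  constructor
  · rw [← integrable_indicator_iff measurableSet_closedBall, funext hind]
    have h0 : Integrable ((closedBall (0 : K) 1).indicator h) (μ.map (E.𝔭 * ·)) := by
      rw [E.map_prime_mul hμ]
      exact ((integrable_indicator_iff measurableSet_closedBall).2 hi).smul_measure_nnreal
    exact h0.comp_measurable (measurable_const_mul _)
  · have hscale := E.integral_zpow_mul hμ 1 ((closedBall (0 : K) 1).indicator h)
    simp only [zpow_one] at hscale
    simp_rw [← hind] at hscale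
    rwa [integral_indicator measurableSet_closedBall, integral_indicator measurableSet_closedBall]
      at hscale

variable {μ} in
lemma integrableOn_comp_prime_mul (hμ : μ (closedBall (0 : K) 1) = 1) {h : K → ℂ}
    (hi : IntegrableOn h (closedBall 0 1) μ) {r : ℕ} (hr : r < p ^ c) :
    IntegrableOn (fun x => h (E.𝔭 * x + E.𝔭 * E.u r)) (closedBall 0 1) μ := by
  have h1 : IntegrableOn (fun x => h (E.𝔭 * x)) (closedBall (E.u r) 1) μ := by
    refine (E.integrableOn_comp_mul_prime hμ hi).1.mono_set ?_
    rw [← E.biUnion_closedBall_u]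
    exact Set.subset_biUnion_of_mem (u := fun r => closedBall (E.u r) 1) (Finset.mem_range.2 hr)
  have h2 := ((measurePreserving_add_right μ (E.u r)).integrableOn_comp_preimage
    (MeasurableEquiv.addRight (E.u r)).measurableEmbedding).2 h1
  rw [preimage_add_closedBall_self] at h2
  refine h2.congr_fun (fun x _ => ?_) measurableSet_closedBall
  simp only [Function.comp, mul_add]

variable {μ} in
/-- `𝔇` is the disjoint union of the `q` cosets `𝔭 u(r) + 𝔭 𝔇`, each of measure `1 / q`. -/
lemma sum_integral_prime_mul (hμ : μ (closedBall (0 : K) 1) = 1) {h : K → ℂ}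
    (hi : IntegrableOn h (closedBall 0 1) μ) :
    ∑ r ∈ Finset.range (p ^ c), ∫ x in closedBall 0 1, h (E.𝔭 * x + E.𝔭 * E.u r) ∂μ =
      (p : ℂ) ^ c * ∫ x in closedBall 0 1, h x ∂μ := by
  obtain ⟨hint, hscale⟩ := E.integrableOn_comp_mul_prime hμ hi
  rw [← hscale, ← E.biUnion_closedBall_u, integral_biUnion_finset _
    (fun _ _ => measurableSet_closedBall)
    (fun i _ j _ hij => E.pairwise_disjoint_closedBall_u hij)]
  · refine Finset.sum_congr rfl fun r _ => ?_
    rw [setIntegral_closedBall_add μ (fun x => h (E.𝔭 * x))]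
    simp_rw [mul_add]
  · intro r hr
    refine hint.mono_set ?_
    rw [← E.biUnion_closedBall_u]
    exact Set.subset_biUnion_of_mem (u := fun r => closedBall (E.u r) 1) hr

end HaarMeasure

/-! ### Fourier series on the unit ball -/

section Parseval

variable {K : Type*} [NontriviallyNormedField K] {p c : ℕ} (E : LocalFieldData K p c)
  [hp : Fact p.Prime] [IsUltrametricDist K] [ProperSpace K] [MeasurableSpace K] [BorelSpace K]
  (μ : Measure K) [μ.IsAddHaarMeasure]

lemma conj_χ (x : K) : conj (E.χ x : ℂ) = E.χ (-x) := by
  rw [AddChar.map_neg_eq_inv, Circle.coe_inv_eq_conj]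

lemma norm_χ (x : K) : ‖(E.χ x : ℂ)‖ = 1 := Circle.norm_coe _

lemma coe_χ_add (x y : K) : (E.χ (x + y) : ℂ) = E.χ x * E.χ y := by
  rw [AddChar.map_add_eq_mul, Circle.coe_mul]

lemma continuous_χ_mul (x : K) : Continuous fun y : K => (E.χ (x * y) : ℂ) :=
  continuous_subtype_val.comp (E.continuous_χ.comp (continuous_const_mul x))

lemma continuous_conj_χ_mul (x : K) : Continuous fun y : K => conj (E.χ (x * y) : ℂ) :=
  Complex.continuous_conj.comp (E.continuous_χ_mul x)

/-- A nontrivial character of `𝔇` has mean zero. -/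
lemma integral_χ_of_one_lt {x : K} (hx : 1 < ‖x‖) :
    ∫ y in closedBall 0 1, (E.χ (x * y) : ℂ) ∂μ = 0 := by
  obtain ⟨z, hz, hne⟩ := E.exists_χ_mul_ne_one hx
  have h := setIntegral_closedBall_zero_add μ (fun y => (E.χ (x * y) : ℂ)) hz
  simp_rw [mul_add, E.coe_χ_add] at h
  rw [integral_mul_const] at h
  have hne' : (E.χ (x * z) : ℂ) - 1 ≠ 0 := by
    rw [sub_ne_zero]
    intro h1
    exact hne (Circle.ext (by simpa using h1))
  have : (∫ y in closedBall 0 1, (E.χ (x * y) : ℂ) ∂μ) * ((E.χ (x * z) : ℂ) - 1) = 0 := by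
    rw [mul_sub, h, mul_one, sub_self]
  exact (mul_eq_zero.1 this).resolve_right hne'

/-- The restriction of the character `y ↦ χ(x y)` to `𝔇`. -/
noncomputable def charD (x : K) : C(closedBall (0 : K) 1, ℂ) :=
  ⟨fun y => (E.χ (x * y) : ℂ), (E.continuous_χ_mul x).comp continuous_subtype_val⟩

lemma charD_apply (x : K) (y : closedBall (0 : K) 1) : E.charD x y = (E.χ (x * y) : ℂ) := rfl

lemma range_charD : Set.range E.charD = Set.range fun k : ℕ => E.charD (E.u k) := by
  refine Set.Subset.antisymm ?_ (by rintro _ ⟨k, rfl⟩; exact ⟨_, rfl⟩)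
  rintro _ ⟨x, rfl⟩
  obtain ⟨k, hk⟩ := E.exists_norm_sub_u_le x
  refine ⟨k, ContinuousMap.ext fun y => ?_⟩
  have hy := mem_closedBall_zero_iff.1 y.2
  have h1 : ‖(x - E.u k) * y‖ ≤ 1 := by
    rw [norm_mul]; exact mul_le_one₀ hk (norm_nonneg _) hy
  have : x * (y : K) = E.u k * y + (x - E.u k) * y := by ring
  simp only [charD_apply]
  rw [this, E.χ_add_right h1]

/-- The algebra of continuous functions on `𝔇` generated by the characters. -/
noncomputable def charSubalgebra : StarSubalgebra ℂ C(closedBall (0 : K) 1, ℂ) where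
  toSubalgebra := Algebra.adjoin ℂ (Set.range E.charD)
  star_mem' := by
    change Algebra.adjoin ℂ (Set.range E.charD) ≤ star (Algebra.adjoin ℂ (Set.range E.charD))
    refine Algebra.adjoin_le ?_
    rintro - ⟨x, rfl⟩
    refine Algebra.subset_adjoin ⟨-x, ContinuousMap.ext fun y => ?_⟩
    rw [ContinuousMap.star_apply, charD_apply, charD_apply, neg_mul, ← E.conj_χ]
    rfl

lemma charSubalgebra_coe :
    Subalgebra.toSubmodule E.charSubalgebra.toSubalgebra =
      Submodule.span ℂ (Set.range E.charD) := by
  apply Algebra.adjoin_eq_span_of_subset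
  refine Set.Subset.trans ?_ Submodule.subset_span
  intro x hx
  refine Submonoid.closure_induction (fun _ => id) ⟨0, ?_⟩ ?_ hx
  · ext1 z; simp [charD_apply]
  · rintro - - - - ⟨m, rfl⟩ ⟨n, rfl⟩
    refine ⟨m + n, ?_⟩
    ext1 z
    rw [ContinuousMap.mul_apply, charD_apply, charD_apply, charD_apply, add_mul, E.coe_χ_add]

lemma charSubalgebra_separatesPoints : E.charSubalgebra.SeparatesPoints := by
  intro x y hxy
  have hz : (x : K) - y ≠ 0 := sub_ne_zero.2 fun h => hxy (Subtype.ext h)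
  refine ⟨_, ⟨E.charD (E.𝔭⁻¹ * ((x : K) - y)⁻¹), Algebra.subset_adjoin ⟨_, rfl⟩, rfl⟩, ?_⟩
  intro h
  have h1 : E.χ (E.𝔭⁻¹ * ((x : K) - y)⁻¹ * x) = E.χ (E.𝔭⁻¹ * ((x : K) - y)⁻¹ * y) :=
    Circle.ext h
  have h2 : E.𝔭⁻¹ * ((x : K) - y)⁻¹ * x = E.𝔭⁻¹ * ((x : K) - y)⁻¹ * y + E.𝔭⁻¹ := by
    rw [← sub_eq_iff_eq_add', ← mul_sub, mul_assoc, inv_mul_cancel₀ hz, mul_one]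
  rw [h2, AddChar.map_add_eq_mul] at h1
  exact E.χ_inv_prime_ne_one (mul_eq_left.1 h1)

lemma span_charD_closure_eq_top :
    (Submodule.span ℂ (Set.range fun k : ℕ => E.charD (E.u k))).topologicalClosure = ⊤ := by
  rw [← range_charD, ← charSubalgebra_coe]
  exact congr_arg (Subalgebra.toSubmodule <| StarSubalgebra.toSubalgebra ·)
    (ContinuousMap.starSubalgebra_topologicalClosure_eq_top_of_separatesPoints E.charSubalgebra
      E.charSubalgebra_separatesPoints)

variable {μ}

/-- Parseval's identity on `𝔇`: the characters `y ↦ χ(u(k) y)` form a Hilbert basis of `L²(𝔇)`. -/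
theorem hasSum_parseval (hμ : μ (closedBall (0 : K) 1) = 1) {g h : K → ℂ}
    (hg : MemLp g 2 (μ.restrict (closedBall 0 1))) (hh : MemLp h 2 (μ.restrict (closedBall 0 1))) :
    HasSum (fun k : ℕ =>
        (∫ y in closedBall 0 1, g y * conj (E.χ (E.u k * y) : ℂ) ∂μ) *
          conj (∫ y in closedBall 0 1, h y * conj (E.χ (E.u k * y) : ℂ) ∂μ))
      (∫ y in closedBall 0 1, g y * conj (h y) ∂μ) := by
  have hD : MeasurableSet (closedBall (0 : K) 1) := measurableSet_closedBall
  let ν : Measure (closedBall (0 : K) 1) := μ.comap Subtype.val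
  have hν : ν.map Subtype.val = μ.restrict (closedBall 0 1) := map_comap_subtype_coe hD μ
  have hν1 : IsFiniteMeasure ν := ⟨by
    rw [comap_subtype_coe_apply hD, Set.image_univ, Subtype.range_coe, hμ]
    exact ENNReal.one_lt_top⟩
  have hcpt : CompactSpace (closedBall (0 : K) 1) :=
    isCompact_iff_compactSpace.1 (isCompact_closedBall _ _)
  let v : ℕ → Lp ℂ 2 ν := fun k => ContinuousMap.toLp 2 ν ℂ (E.charD (E.u k))
  have hv : Orthonormal ℂ v := by
    rw [orthonormal_iff_ite]
    intro i j
    change inner ℂ (ContinuousMap.toLp 2 ν ℂ _) (ContinuousMap.toLp 2 ν ℂ _) = _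
    rw [ContinuousMap.inner_toLp]
    simp only [charD_apply]
    have e : ∀ y : closedBall (0 : K) 1, (E.χ (E.u j * y) : ℂ) * conj (E.χ (E.u i * y) : ℂ) =
        (fun y : K => (E.χ ((E.u j - E.u i) * y) : ℂ)) y := fun y => by
      rw [E.conj_χ, ← E.coe_χ_add]
      simp only [sub_eq_add_neg, add_mul, neg_mul]
    simp_rw [e]
    rw [integral_subtype_comap hD (fun y : K => (E.χ ((E.u j - E.u i) * y) : ℂ))]
    split_ifs with hij
    · subst hij
      simp [Measure.real, hμ]
    · apply E.integral_χ_of_one_lt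
      by_contra! hle
      exact hij (E.u_inj_mod j i hle).symm
  have hspan : ⊤ ≤ (Submodule.span ℂ (Set.range v)).topologicalClosure := by
    have := (ContinuousMap.toLp_denseRange ℂ ν ℂ
      (ENNReal.ofNat_ne_top (n := 2))).topologicalClosure_map_submodule E.span_charD_closure_eq_top
    rw [Submodule.map_span, ← Set.range_comp] at this
    exact this.ge
  let b := HilbertBasis.mk hv hspan
  have hb : ∀ k, b k = v k := fun k => by simp [b]
  have hL : ∀ {f : K → ℂ}, MemLp f 2 (μ.restrict (closedBall 0 1)) →
      MemLp (fun y : closedBall (0 : K) 1 => f y) 2 ν := fun hf =>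
    hf.comp_measurePreserving ⟨measurable_subtype_coe, hν⟩
  have hcoef : ∀ {f : K → ℂ} (hf : MemLp f 2 (μ.restrict (closedBall 0 1))) (k : ℕ),
      inner ℂ (v k) ((hL hf).toLp _) =
        ∫ y in closedBall 0 1, f y * conj (E.χ (E.u k * y) : ℂ) ∂μ := by
    intro f hf k
    rw [← integral_subtype_comap hD (fun y : K => f y * conj (E.χ (E.u k * y) : ℂ)), L2.inner_def]
    refine integral_congr_ae ?_
    filter_upwards [(hL hf).coeFn_toLp, ContinuousMap.coeFn_toLp (p := 2) (𝕜 := ℂ) ν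
      (E.charD (E.u k))] with y h1 h2
    rw [h1, h2]
    rfl
  have hmain := b.hasSum_inner_mul_inner ((hL hh).toLp _) ((hL hg).toLp _)
  have hlim : inner ℂ ((hL hh).toLp _) ((hL hg).toLp _) =
      ∫ y in closedBall 0 1, g y * conj (h y) ∂μ := by
    rw [← integral_subtype_comap hD (fun y : K => g y * conj (h y)), L2.inner_def]
    refine integral_congr_ae ?_
    filter_upwards [(hL hg).coeFn_toLp, (hL hh).coeFn_toLp] with y h1 h2
    rw [h1, h2]
    rfl
  rw [hlim] at hmain
  refine hmain.congr_fun ?_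
  intro k
  rw [hb, hcoef hg, ← inner_conj_symm, hcoef hh, mul_comm]

/-- Parseval's identity on `𝔇` for the conjugate characters. -/
theorem hasSum_parseval_conj (hμ : μ (closedBall (0 : K) 1) = 1) {g h : K → ℂ}
    (hg : MemLp g 2 (μ.restrict (closedBall 0 1))) (hh : MemLp h 2 (μ.restrict (closedBall 0 1))) :
    HasSum (fun k : ℕ =>
        (∫ y in closedBall 0 1, g y * (E.χ (E.u k * y) : ℂ) ∂μ) *
          conj (∫ y in closedBall 0 1, h y * (E.χ (E.u k * y) : ℂ) ∂μ))
      (∫ y in closedBall 0 1, g y * conj (h y) ∂μ) := by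
  have h1 := E.hasSum_parseval hμ hh.star hg.star
  convert h1 using 1
  · funext k
    rw [← integral_conj, ← integral_conj, mul_comm]
    simp
  · simp [mul_comm]

end Parseval

/-! ### Fourier integrals of boundedly supported functions -/

section Plancherel

lemma eLpNorm_two_sq {α : Type*} [MeasurableSpace α] (ν : Measure α) (f : α → ℂ) :
    eLpNorm f 2 ν ^ 2 = ∫⁻ x, ‖f x‖ₑ ^ 2 ∂ν := by
  have := eLpNorm_nnreal_pow_eq_lintegral (f := f) (μ := ν) (p := 2) two_ne_zero
  simpa using this

lemma eLpNorm_two_congr {α β : Type*} [MeasurableSpace α] [MeasurableSpace β] {ν : Measure α}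
    {ρ : Measure β} {f : α → ℂ} {g : β → ℂ}
    (h : ∫⁻ x, ‖f x‖ₑ ^ 2 ∂ν = ∫⁻ x, ‖g x‖ₑ ^ 2 ∂ρ) : eLpNorm f 2 ν = eLpNorm g 2 ρ := by
  rw [← eLpNorm_two_sq, ← eLpNorm_two_sq] at h
  exact (ENNReal.pow_right_strictMono two_ne_zero).injective h

lemma lintegral_enorm_sq_eq {α : Type*} [MeasurableSpace α] {ν : Measure α} {f : α → ℂ}
    (hf : MemLp f 2 ν) : ∫⁻ x, ‖f x‖ₑ ^ 2 ∂ν = ENNReal.ofReal (∫ x, ‖f x‖ ^ 2 ∂ν) := by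
  rw [ofReal_integral_eq_lintegral_ofReal ((memLp_two_iff_integrable_sq_norm hf.1).1 hf)
    (ae_of_all _ fun _ => by positivity)]
  refine lintegral_congr fun x => ?_
  rw [ENNReal.ofReal_pow (norm_nonneg _), ofReal_norm]

lemma integral_mul_conj_self {α : Type*} [MeasurableSpace α] (ν : Measure α) (f : α → ℂ) :
    ∫ x, f x * conj (f x) ∂ν = ((∫ x, ‖f x‖ ^ 2 ∂ν : ℝ) : ℂ) := by
  rw [← integral_complex_ofReal]
  refine integral_congr_ae (ae_of_all _ fun x => ?_)
  simp [Complex.mul_conj, Complex.normSq_eq_norm_sq]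

lemma inner_toLp {α : Type*} [MeasurableSpace α] {ν : Measure α} {f g : α → ℂ}
    (hf : MemLp f 2 ν) (hg : MemLp g 2 ν) :
    inner ℂ (hg.toLp g) (hf.toLp f) = ∫ x, f x * conj (g x) ∂ν := by
  rw [L2.inner_def]
  refine integral_congr_ae ?_
  filter_upwards [hf.coeFn_toLp, hg.coeFn_toLp] with x h1 h2
  rw [h1, h2]
  rfl

variable {K : Type*} [NontriviallyNormedField K] {p c : ℕ} (E : LocalFieldData K p c)
  [hp : Fact p.Prime] [IsUltrametricDist K] [ProperSpace K] [MeasurableSpace K] [BorelSpace K]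
  (μ : Measure K) [μ.IsAddHaarMeasure]

/-- The Fourier integral `∫ f(x) conj (χ(ξ x)) dx`. -/
noncomputable def ft (f : K → ℂ) (ξ : K) : ℂ := ∫ x, f x * conj (E.χ (ξ * x) : ℂ) ∂μ

/-- The unitary dilation `x ↦ q^{n/2} f(𝔭⁻ⁿ x)`. -/
noncomputable def dil (n : ℤ) (f : K → ℂ) (x : K) : ℂ :=
  ((Real.sqrt ((p : ℝ) ^ c) ^ n : ℝ) : ℂ) * f (E.𝔭 ^ (-n) * x)

lemma integrable_mul_conj_χ {f : K → ℂ} {ν : Measure K} (hf : Integrable f ν) (ξ : K) :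
    Integrable (fun x => f x * conj (E.χ (ξ * x) : ℂ)) ν := by
  refine hf.mul_bdd (c := 1) (E.continuous_conj_χ_mul ξ).aestronglyMeasurable
    (ae_of_all _ fun x => ?_)
  rw [RCLike.norm_conj, norm_χ]

lemma integrable_mul_χ {f : K → ℂ} {ν : Measure K} (hf : Integrable f ν) (ξ : K) :
    Integrable (fun x => f x * (E.χ (ξ * x) : ℂ)) ν := by
  refine hf.mul_bdd (c := 1) (E.continuous_χ_mul ξ).aestronglyMeasurable
    (ae_of_all _ fun x => ?_)
  rw [norm_χ]

lemma continuous_ft {f : K → ℂ} (hf : Integrable f μ) : Continuous (E.ft μ f) := by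
  refine continuous_of_dominated (bound := fun x => ‖f x‖)
    (fun ξ => (E.integrable_mul_conj_χ hf ξ).1) (fun ξ => ae_of_all _ fun x => ?_) hf.norm
    (ae_of_all _ fun x => ?_)
  · rw [norm_mul, RCLike.norm_conj, norm_χ, mul_one]
  · simp_rw [mul_comm _ x]
    exact continuous_const.mul (E.continuous_conj_χ_mul x)

lemma norm_ft_le (f : K → ℂ) (ξ : K) : ‖E.ft μ f ξ‖ ≤ ∫ x, ‖f x‖ ∂μ := by
  refine (norm_integral_le_integral_norm _).trans (le_of_eq ?_)
  simp [norm_χ]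

lemma ft_add {f g : K → ℂ} (hf : Integrable f μ) (hg : Integrable g μ) (ξ : K) :
    E.ft μ (fun x => f x + g x) ξ = E.ft μ f ξ + E.ft μ g ξ := by
  rw [ft, ft, ft, ← integral_add (E.integrable_mul_conj_χ hf ξ) (E.integrable_mul_conj_χ hg ξ)]
  simp_rw [add_mul]

lemma ft_const_mul (a : ℂ) (f : K → ℂ) (ξ : K) :
    E.ft μ (fun x => a * f x) ξ = a * E.ft μ f ξ := by
  rw [ft, ft, ← integral_const_mul]
  simp_rw [mul_assoc]

lemma ft_indicator (f : K → ℂ) (R : ℝ) (ξ : K) :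
    E.ft μ ((closedBall 0 R).indicator f) ξ =
      ∫ x in closedBall 0 R, f x * conj (E.χ (ξ * x) : ℂ) ∂μ := by
  rw [ft, ← integral_indicator measurableSet_closedBall]
  congr 1; ext x
  simp only [Set.indicator]
  split_ifs <;> simp

variable {μ}

lemma integrableOn_closedBall {f : K → ℂ} (hf : MemLp f 2 μ) (x : K) (R : ℝ) :
    IntegrableOn f (closedBall x R) μ := by
  have : IsFiniteMeasure (μ.restrict (closedBall x R)) :=
    ⟨by rw [Measure.restrict_apply_univ]; exact measure_closedBall_lt_top⟩
  exact (hf.restrict _).integrable one_le_two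

lemma indicator_eq_self_of_support {f : K → ℂ} {R : ℝ} (h : ∀ x, R < ‖x‖ → f x = 0) :
    (closedBall (0 : K) R).indicator f = f := by
  refine Set.indicator_eq_self.2 fun x hx => ?_
  rw [mem_closedBall_zero_iff]
  by_contra! hlt
  exact hx (h x hlt)

lemma integrable_of_support {f : K → ℂ} (hf : MemLp f 2 μ) {R : ℝ}
    (h : ∀ x, R < ‖x‖ → f x = 0) : Integrable f μ := by
  rw [← indicator_eq_self_of_support h, integrable_indicator_iff measurableSet_closedBall]
  exact integrableOn_closedBall hf _ _

lemma indicator_support (f : K → ℂ) {R : ℝ} (x : K) (hx : R < ‖x‖) :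
    (closedBall (0 : K) R).indicator f x = 0 :=
  Set.indicator_of_notMem (by simpa using hx) _

lemma memLp_indicator {f : K → ℂ} (hf : MemLp f 2 μ) (R : ℝ) :
    MemLp ((closedBall (0 : K) R).indicator f) 2 μ := hf.indicator measurableSet_closedBall

lemma integrable_indicator_of_memLp {f : K → ℂ} (hf : MemLp f 2 μ) (R : ℝ) :
    Integrable ((closedBall (0 : K) R).indicator f) μ :=
  integrable_of_support (memLp_indicator hf R) (indicator_support f)

lemma sqrt_q_zpow_ne (E : LocalFieldData K p c) (n : ℤ) :
    ((Real.sqrt ((p : ℝ) ^ c) ^ n : ℝ) : ℂ) ≠ 0 := by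
  have := E.q_real_pos
  exact_mod_cast (zpow_pos (Real.sqrt_pos.2 this) n).ne'

lemma sqrt_q_zpow_sq (E : LocalFieldData K p c) (n : ℤ) :
    (((Real.sqrt ((p : ℝ) ^ c) ^ n : ℝ) : ℂ)) ^ 2 = ((p : ℂ) ^ c) ^ n := by
  have := E.q_real_pos
  rw [← Complex.ofReal_pow, ← zpow_natCast, zpow_comm, zpow_natCast, Real.sq_sqrt this.le]
  push_cast
  rfl

lemma sqrt_q_zpow_neg (_E : LocalFieldData K p c) (n : ℤ) :
    ((Real.sqrt ((p : ℝ) ^ c) ^ (-n) : ℝ) : ℂ) =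
      (((Real.sqrt ((p : ℝ) ^ c) ^ n : ℝ) : ℂ))⁻¹ := by
  rw [zpow_neg]; push_cast; rfl

lemma lintegral_dil (hμ : μ (closedBall (0 : K) 1) = 1) (n : ℤ) (f : K → ℂ) :
    ∫⁻ x, ‖E.dil n f x‖ₑ ^ 2 ∂μ = ∫⁻ x, ‖f x‖ₑ ^ 2 ∂μ := by
  have hq := E.q_real_pos
  have hq' : ((p : ℝ≥0) ^ c) ≠ 0 := by have := hp.out.ne_zero; positivity
  have hn : ‖((Real.sqrt ((p : ℝ) ^ c) ^ n : ℝ) : ℂ)‖ₑ ^ 2 =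
      ((((p : ℝ≥0) ^ c) ^ n : ℝ≥0) : ℝ≥0∞) := by
    rw [← enorm_pow, E.sqrt_q_zpow_sq, enorm_eq_nnnorm]
    congr 1
    rw [nnnorm_zpow, nnnorm_pow]
    simp
  simp_rw [dil, enorm_mul, mul_pow, hn]
  rw [lintegral_const_mul' _ _ ENNReal.coe_ne_top,
    E.lintegral_zpow_mul hμ (-n) (fun x => ‖f x‖ₑ ^ 2), ← mul_assoc, ← ENNReal.coe_mul, zpow_neg,
    mul_inv_cancel₀ (zpow_ne_zero _ hq'), ENNReal.coe_one, one_mul]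

lemma eLpNorm_dil (hμ : μ (closedBall (0 : K) 1) = 1) (n : ℤ) (f : K → ℂ) :
    eLpNorm (E.dil n f) 2 μ = eLpNorm f 2 μ :=
  eLpNorm_two_congr (E.lintegral_dil hμ n f)

lemma memLp_dil (hμ : μ (closedBall (0 : K) 1) = 1) (n : ℤ) {f : K → ℂ} (hf : MemLp f 2 μ) :
    MemLp (E.dil n f) 2 μ := by
  refine ⟨?_, by rw [E.eLpNorm_dil hμ]; exact hf.2⟩
  exact (hf.1.comp_quasiMeasurePreserving
    (E.quasiMeasurePreserving_zpow_mul hμ (-n))).const_mul _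

lemma dil_dil (m n : ℤ) (f : K → ℂ) : E.dil m (E.dil n f) = E.dil (m + n) f := by
  have hq := (Real.sqrt_pos.2 E.q_real_pos).ne'
  funext x
  rw [dil, dil, dil, zpow_add₀ hq, neg_add_rev, zpow_add₀ E.prime_ne_zero]
  push_cast
  ring_nf

lemma dil_zero (f : K → ℂ) : E.dil 0 f = f := by funext x; simp [dil]

lemma ft_dil (hμ : μ (closedBall (0 : K) 1) = 1) (n : ℤ) (f : K → ℂ) :
    E.ft μ (E.dil n f) = E.dil (-n) (E.ft μ f) := by
  funext ξ
  have h0 := E.sqrt_q_zpow_ne n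
  have h1 : ∀ x, E.dil n f x * conj (E.χ (ξ * x) : ℂ) =
      ((Real.sqrt ((p : ℝ) ^ c) ^ n : ℝ) : ℂ) *
        (fun y => f y * conj (E.χ (E.𝔭 ^ n * ξ * y) : ℂ)) (E.𝔭 ^ (-n) * x) := by
    intro x
    have : E.𝔭 ^ n * ξ * (E.𝔭 ^ (-n) * x) = ξ * x := by
      rw [zpow_neg]; field_simp [E.prime_ne_zero]
    simp only [dil, this]
    ring
  rw [ft]
  simp_rw [h1]
  rw [integral_const_mul, E.integral_zpow_mul hμ (-n)
    (fun y => f y * conj (E.χ (E.𝔭 ^ n * ξ * y) : ℂ)), ← E.sqrt_q_zpow_sq, dil, neg_neg, ft,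
    E.sqrt_q_zpow_neg, ← mul_assoc]
  congr 1
  field_simp

/-- Plancherel for functions supported in `𝔇`: the transform is constant on the cosets of `𝔇`,
where its values are the Fourier coefficients of `f`. -/
lemma lintegral_ft_of_support_unit (hμ : μ (closedBall (0 : K) 1) = 1) {f : K → ℂ}
    (hf : MemLp f 2 μ) (h : ∀ x, 1 < ‖x‖ → f x = 0) :
    ∫⁻ ξ, ‖E.ft μ f ξ‖ₑ ^ 2 ∂μ = ∫⁻ x, ‖f x‖ₑ ^ 2 ∂μ := by
  have hconst : ∀ k : ℕ, ∀ y ∈ closedBall (0 : K) 1, E.ft μ f (y + E.u k) =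
      ∫ x in closedBall 0 1, f x * conj (E.χ (E.u k * x) : ℂ) ∂μ := by
    intro k y hy
    rw [← ft_indicator, indicator_eq_self_of_support h]
    refine integral_congr_ae (ae_of_all _ fun x => ?_)
    by_cases hx : 1 < ‖x‖
    · simp [h x hx]
    · have : ‖y * x‖ ≤ 1 := by
        rw [norm_mul]
        exact mul_le_one₀ (mem_closedBall_zero_iff.1 hy) (norm_nonneg _) (not_lt.1 hx)
      simp only
      rw [add_mul, add_comm, E.χ_add_right this]
  have hP := E.hasSum_parseval hμ (hf.restrict _) (hf.restrict (closedBall 0 1))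
  rw [integral_mul_conj_self] at hP
  simp_rw [Complex.mul_conj, Complex.normSq_eq_norm_sq] at hP
  have hP' := Complex.hasSum_ofReal.1 hP
  rw [E.lintegral_eq_tsum μ]
  have h1 : ∀ k : ℕ, ∫⁻ x in closedBall 0 1, ‖E.ft μ f (x + E.u k)‖ₑ ^ 2 ∂μ =
      ENNReal.ofReal (‖∫ x in closedBall 0 1, f x * conj (E.χ (E.u k * x) : ℂ) ∂μ‖ ^ 2) := by
    intro k
    rw [setLIntegral_congr_fun (g := fun _ => ‖∫ x in closedBall 0 1,
        f x * conj (E.χ (E.u k * x) : ℂ) ∂μ‖ₑ ^ 2) measurableSet_closedBall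
      (fun y hy => by simp only [hconst k y hy]), setLIntegral_const, hμ, mul_one,
      ENNReal.ofReal_pow (norm_nonneg _), ofReal_norm]
  simp_rw [h1]
  rw [← ENNReal.ofReal_tsum_of_nonneg (fun _ => by positivity) hP'.summable, hP'.tsum_eq,
    ← lintegral_enorm_sq_eq (hf.restrict _), ← lintegral_indicator measurableSet_closedBall]
  refine lintegral_congr fun x => ?_
  by_cases hx : 1 < ‖x‖
  · simp [h x hx]
  · rw [Set.indicator_of_mem (by simpa using hx)]

/-- Plancherel for boundedly supported functions. -/
lemma eLpNorm_ft_of_support (hμ : μ (closedBall (0 : K) 1) = 1) {f : K → ℂ}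
    (hf : MemLp f 2 μ) {R : ℝ} (h : ∀ x, R < ‖x‖ → f x = 0) :
    eLpNorm (E.ft μ f) 2 μ = eLpNorm f 2 μ := by
  -- dilate the support into `𝔇`
  obtain ⟨N, hN⟩ := E.exists_pow_mul_norm_le (K := K) R
  have h1 : ∀ x : K, 1 < ‖x‖ → E.dil N f x = 0 := by
    intro x hx
    rw [dil, h, mul_zero]
    by_contra! hle
    have := hN _ hle
    rw [← norm_pow, ← norm_mul, zpow_neg, zpow_natCast,
      mul_inv_cancel_left₀ (pow_ne_zero _ E.prime_ne_zero)] at this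
    exact hx.not_ge this
  have h2 := E.lintegral_ft_of_support_unit hμ (E.memLp_dil hμ N hf) h1
  rw [E.ft_dil hμ, E.lintegral_dil hμ, E.lintegral_dil hμ] at h2
  exact eLpNorm_two_congr h2

lemma memLp_ft_of_support (hμ : μ (closedBall (0 : K) 1) = 1) {f : K → ℂ}
    (hf : MemLp f 2 μ) {R : ℝ} (h : ∀ x, R < ‖x‖ → f x = 0) : MemLp (E.ft μ f) 2 μ :=
  ⟨(E.continuous_ft μ (integrable_of_support hf h)).aestronglyMeasurable, by
    rw [E.eLpNorm_ft_of_support hμ hf h]; exact hf.2⟩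

lemma tendsto_eLpNorm_sub_indicator {f : K → ℂ} (hf : MemLp f 2 μ) :
    Tendsto (fun R : ℝ => eLpNorm (fun x => f x - (closedBall (0 : K) R).indicator f x) 2 μ)
      atTop (𝓝 0) := by
  have h1 : Tendsto (fun R : ℝ => ∫⁻ x, ‖f x - (closedBall (0 : K) R).indicator f x‖ₑ ^ 2 ∂μ)
      atTop (𝓝 (∫⁻ _, 0 ∂μ)) := by
    refine tendsto_lintegral_filter_of_dominated_convergence' (fun x => ‖f x‖ₑ ^ 2)
      (Eventually.of_forall fun R => ?_) (Eventually.of_forall fun R => ae_of_all _ fun x => ?_)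
      ?_ (ae_of_all _ fun x => ?_)
    · exact ((hf.1.sub (memLp_indicator hf R).1).enorm).pow_const 2
    · by_cases hx : x ∈ closedBall (0 : K) R
      · simp [Set.indicator_of_mem hx]
      · simp [Set.indicator_of_notMem hx]
    · rw [lintegral_enorm_sq_eq hf]; exact ENNReal.ofReal_ne_top
    · refine tendsto_const_nhds.congr' ?_
      filter_upwards [eventually_ge_atTop ‖x‖] with R hR
      rw [Set.indicator_of_mem (by simpa using hR)]
      simp
  rw [lintegral_zero] at h1
  simp_rw [← eLpNorm_two_sq] at h1
  have h2 := h1.ennrpow_const (1 / 2)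
  have h3 : ∀ a : ℝ≥0∞, (a ^ 2) ^ (1 / 2 : ℝ) = a := fun a => by
    rw [← ENNReal.rpow_two, ← ENNReal.rpow_mul]; norm_num
  simp_rw [h3] at h2
  rwa [ENNReal.zero_rpow_of_pos (by norm_num)] at h2

end Plancherel

/-! ### The Fourier transform on `L²(K)` -/

section FourierTransform

lemma inner_eq_of_norm_add_smul_eq {H H' : Type*} [NormedAddCommGroup H] [InnerProductSpace ℂ H]
    [NormedAddCommGroup H'] [InnerProductSpace ℂ H'] {x y : H} {x' y' : H'}
    (h : ∀ a : ℂ, ‖x + a • y‖ = ‖x' + a • y'‖) : inner ℂ x y = inner ℂ x' y' := by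
  have h1 := h 1
  have h2 := h (-1)
  have h3 := h Complex.I
  have h4 := h (-Complex.I)
  simp only [one_smul, neg_smul, ← sub_eq_add_neg] at h1 h2 h3 h4
  rw [inner_eq_sum_norm_sq_div_four, inner_eq_sum_norm_sq_div_four, RCLike.I_to_complex, h1, h2,
    h3, h4]

variable {K : Type*} [NontriviallyNormedField K] {p c : ℕ} {E : LocalFieldData K p c}
  [hp : Fact p.Prime] [IsUltrametricDist K] [ProperSpace K] [MeasurableSpace K] [BorelSpace K]
  {μ : Measure K} [μ.IsAddHaarMeasure]

lemma isFourierTransform_iff {f g : K → ℂ} : E.IsFourierTransform μ f g ↔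
    MemLp f 2 μ ∧ MemLp g 2 μ ∧ Tendsto (fun n : ℕ => eLpNorm
      (fun ξ => g ξ - E.ft μ ((closedBall (0 : K) n).indicator f) ξ) 2 μ) atTop (𝓝 0) := by
  simp_rw [ft_indicator]
  rfl

/-- For a boundedly supported function the Fourier integral is the Fourier transform. -/
lemma isFourierTransform_ft (hμ : μ (closedBall (0 : K) 1) = 1) {f : K → ℂ}
    (hf : MemLp f 2 μ) {R : ℝ} (h : ∀ x, R < ‖x‖ → f x = 0) :
    E.IsFourierTransform μ f (E.ft μ f) := by
  refine isFourierTransform_iff.2 ⟨hf, E.memLp_ft_of_support hμ hf h, ?_⟩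
  refine tendsto_const_nhds.congr' ?_
  filter_upwards [eventually_ge_atTop ⌈R⌉₊] with n hn
  rw [indicator_eq_self_of_support fun x hx => h x
    ((Nat.le_ceil R).trans_lt (lt_of_le_of_lt (Nat.cast_le.2 hn) hx))]
  simp

lemma IsFourierTransform.add {f f' g g' : K → ℂ}
    (h : E.IsFourierTransform μ f g) (h' : E.IsFourierTransform μ f' g') :
    E.IsFourierTransform μ (fun x => f x + f' x) (fun ξ => g ξ + g' ξ) := by
  rw [isFourierTransform_iff] at h h' ⊢
  refine ⟨h.1.add h'.1, h.2.1.add h'.2.1, ?_⟩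
  have hsum := h.2.2.add h'.2.2
  rw [add_zero] at hsum
  refine tendsto_of_tendsto_of_tendsto_of_le_of_le tendsto_const_nhds hsum (fun _ => zero_le) ?_
  intro n
  have hm : ∀ {F : K → ℂ}, MemLp F 2 μ →
      AEStronglyMeasurable (E.ft μ ((closedBall (0 : K) n).indicator F)) μ := fun hF =>
    (E.continuous_ft μ (integrable_indicator_of_memLp hF n)).aestronglyMeasurable
  have e : (closedBall (0 : K) n).indicator (fun x => f x + f' x) =
      fun x => (closedBall (0 : K) n).indicator f x + (closedBall (0 : K) n).indicator f' x :=
    Set.indicator_add _ f f'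
  have e2 : (fun ξ => g ξ + g' ξ -
        E.ft μ ((closedBall (0 : K) n).indicator (fun x => f x + f' x)) ξ) =
      (fun ξ => g ξ - E.ft μ ((closedBall (0 : K) n).indicator f) ξ) +
        fun ξ => g' ξ - E.ft μ ((closedBall (0 : K) n).indicator f') ξ := by
    funext ξ
    rw [e, E.ft_add μ (integrable_indicator_of_memLp h.1 n)
      (integrable_indicator_of_memLp h'.1 n) ξ, Pi.add_apply]
    ring
  simp only [e2]
  exact eLpNorm_add_le (h.2.1.1.sub (hm h.1)) (h'.2.1.1.sub (hm h'.1)) one_le_two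

lemma IsFourierTransform.const_mul {f g : K → ℂ} (h : E.IsFourierTransform μ f g) (a : ℂ) :
    E.IsFourierTransform μ (fun x => a * f x) (fun ξ => a * g ξ) := by
  rw [isFourierTransform_iff] at h ⊢
  refine ⟨h.1.const_mul a, h.2.1.const_mul a, ?_⟩
  have h1 := ENNReal.Tendsto.const_mul (a := ‖a‖ₑ) h.2.2 (Or.inr enorm_ne_top)
  rw [mul_zero] at h1
  refine h1.congr fun n => ?_
  rw [← eLpNorm_const_smul]
  congr 1
  funext ξ
  have e : (closedBall (0 : K) n).indicator (fun x => a * f x) =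
      fun x => a * (closedBall (0 : K) n).indicator f x := by
    funext x; simp only [Set.indicator]; split_ifs <;> simp
  rw [e, E.ft_const_mul, Pi.smul_apply, smul_eq_mul, mul_sub]

lemma IsFourierTransform.sub {f f' g g' : K → ℂ}
    (h : E.IsFourierTransform μ f g) (h' : E.IsFourierTransform μ f' g') :
    E.IsFourierTransform μ (fun x => f x - f' x) (fun ξ => g ξ - g' ξ) := by
  simpa [sub_eq_add_neg] using h.add (h'.const_mul (-1))

lemma IsFourierTransform.sum {ι : Type*} (s : Finset ι)
    {f g : ι → K → ℂ} (h : ∀ i ∈ s, E.IsFourierTransform μ (f i) (g i)) :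
    E.IsFourierTransform μ (fun x => ∑ i ∈ s, f i x) (fun ξ => ∑ i ∈ s, g i ξ) := by
  classical
  induction s using Finset.induction_on with
  | empty =>
    simp only [Finset.sum_empty]
    refine ⟨MemLp.zero', MemLp.zero', ?_⟩
    simp
  | insert i s hi ih =>
    simp_rw [Finset.sum_insert hi]
    exact (h i (Finset.mem_insert_self i s)).add
      (ih fun j hj => h j (Finset.mem_insert_of_mem hj))

/-- The Plancherel theorem. -/
theorem IsFourierTransform.eLpNorm_eq (hμ : μ (closedBall (0 : K) 1) = 1) {f g : K → ℂ}
    (h : E.IsFourierTransform μ f g) : eLpNorm g 2 μ = eLpNorm f 2 μ := by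
  rw [isFourierTransform_iff] at h
  obtain ⟨hf, hg, hlim⟩ := h
  have hft : ∀ n : ℕ, MemLp (E.ft μ ((closedBall (0 : K) n).indicator f)) 2 μ := fun n =>
    E.memLp_ft_of_support hμ (memLp_indicator hf n) (indicator_support f)
  have h1 : Tendsto (fun n : ℕ => (hft n).toLp _) atTop (𝓝 (hg.toLp g)) := by
    rw [Lp.tendsto_Lp_iff_tendsto_eLpNorm'']
    refine hlim.congr fun n => ?_
    rw [← eLpNorm_neg]
    congr 1; funext ξ; simp
  have h2 : Tendsto (fun n : ℕ => (memLp_indicator hf n).toLp _) atTop (𝓝 (hf.toLp f)) := by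
    rw [Lp.tendsto_Lp_iff_tendsto_eLpNorm'']
    refine ((tendsto_eLpNorm_sub_indicator hf).comp tendsto_natCast_atTop_atTop).congr fun n => ?_
    simp only [Function.comp]
    rw [← eLpNorm_neg]
    congr 1; funext ξ; simp
  have h3 := h1.norm
  simp only [Lp.norm_toLp] at h3
  have h4 := h2.norm
  simp only [Lp.norm_toLp] at h4
  have h5 : ∀ n : ℕ, eLpNorm (E.ft μ ((closedBall (0 : K) n).indicator f)) 2 μ =
      eLpNorm ((closedBall (0 : K) n).indicator f) 2 μ := fun n =>
    E.eLpNorm_ft_of_support hμ (memLp_indicator hf n) (indicator_support f)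
  simp_rw [h5] at h3
  exact (ENNReal.toReal_eq_toReal_iff' hg.2.ne hf.2.ne).1 (tendsto_nhds_unique h3 h4)

/-- The transform as a limit over all balls, not only over those of integral radius. -/
lemma IsFourierTransform.tendsto_real (hμ : μ (closedBall (0 : K) 1) = 1) {f g : K → ℂ}
    (h : E.IsFourierTransform μ f g) :
    Tendsto (fun R : ℝ => eLpNorm
      (fun ξ => g ξ - E.ft μ ((closedBall (0 : K) R).indicator f) ξ) 2 μ) atTop (𝓝 0) := by
  refine (tendsto_eLpNorm_sub_indicator h.1).congr fun R => ?_
  exact ((h.sub (isFourierTransform_ft hμ (memLp_indicator h.1 R)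
    (indicator_support f))).eLpNorm_eq hμ).symm

/-- Parseval's relation, from the Plancherel theorem by polarization. -/
theorem IsFourierTransform.integral_mul_conj (hμ : μ (closedBall (0 : K) 1) = 1)
    {f g F G : K → ℂ} (hf : E.IsFourierTransform μ f F) (hg : E.IsFourierTransform μ g G) :
    ∫ x, f x * conj (g x) ∂μ = ∫ ξ, F ξ * conj (G ξ) ∂μ := by
  have key : ∀ a : ℂ, ‖hg.1.toLp g + a • hf.1.toLp f‖ = ‖hg.2.1.toLp G + a • hf.2.1.toLp F‖ := by
    intro a
    have := (hg.add (hf.const_mul a)).eLpNorm_eq hμ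
    rw [← MemLp.toLp_const_smul, ← MemLp.toLp_const_smul, ← MemLp.toLp_add, ← MemLp.toLp_add,
      Lp.norm_toLp, Lp.norm_toLp]
    exact congrArg ENNReal.toReal this.symm
  rw [← inner_toLp hf.1 hg.1, ← inner_toLp hf.2.1 hg.2.1]
  exact inner_eq_of_norm_add_smul_eq key

lemma measurePreserving_sub (y : K) : MeasurePreserving (fun x : K => x - y) μ μ :=
  measurePreserving_sub_right μ y

lemma memLp_comp_sub {f : K → ℂ} (hf : MemLp f 2 μ) (y : K) : MemLp (fun x => f (x - y)) 2 μ :=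
  hf.comp_measurePreserving (measurePreserving_sub y)

lemma ft_comp_sub (f : K → ℂ) (y ξ : K) :
    E.ft μ (fun x => f (x - y)) ξ = conj (E.χ (y * ξ) : ℂ) * E.ft μ f ξ := by
  rw [ft, ← integral_add_right_eq_self _ y, ft, ← integral_const_mul]
  refine integral_congr_ae (ae_of_all _ fun x => ?_)
  simp only [add_sub_cancel_right]
  rw [mul_add, E.coe_χ_add, map_mul, mul_comm ξ y]
  ring

lemma memLp_conj_χ_mul {F : K → ℂ} {ν : Measure K} (hF : MemLp F 2 ν) (y : K) :
    MemLp (fun ξ => conj (E.χ (y * ξ) : ℂ) * F ξ) 2 ν := by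
  refine hF.of_le ((E.continuous_conj_χ_mul y).aestronglyMeasurable.mul hF.1)
    (ae_of_all _ fun x => ?_)
  rw [norm_mul, RCLike.norm_conj, norm_χ, one_mul]

/-- Translation becomes modulation. -/
lemma IsFourierTransform.comp_sub {f F : K → ℂ}
    (h : E.IsFourierTransform μ f F) (y : K) :
    E.IsFourierTransform μ (fun x => f (x - y)) (fun ξ => conj (E.χ (y * ξ) : ℂ) * F ξ) := by
  rw [isFourierTransform_iff] at h ⊢
  refine ⟨memLp_comp_sub h.1 y, memLp_conj_χ_mul h.2.1 y, h.2.2.congr' ?_⟩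
  filter_upwards [eventually_ge_atTop ⌈‖y‖⌉₊] with n hn
  have hy : ‖y‖ ≤ n := (Nat.le_ceil _).trans (Nat.cast_le.2 hn)
  have e : (closedBall (0 : K) n).indicator (fun x => f (x - y)) =
      fun x => (closedBall (0 : K) n).indicator f (x - y) := by
    funext x
    have := preimage_add_closedBall (y := -y) (r := n) (by rwa [norm_neg])
    have h2 : x - y ∈ closedBall (0 : K) n ↔ x ∈ closedBall (0 : K) n := by
      have h3 := Set.ext_iff.1 this x
      rwa [Set.mem_preimage, ← sub_eq_add_neg] at h3
    classical
    exact if_congr h2.symm rfl rfl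
  rw [e]
  refine eLpNorm_congr_norm_ae (ae_of_all _ fun ξ => ?_)
  rw [ft_comp_sub, ← mul_sub, norm_mul, RCLike.norm_conj, norm_χ, one_mul]

/-- The transform intertwines the dilations. -/
lemma IsFourierTransform.dil (hμ : μ (closedBall (0 : K) 1) = 1) {f F : K → ℂ}
    (h : E.IsFourierTransform μ f F) (n : ℤ) :
    E.IsFourierTransform μ (E.dil n f) (E.dil (-n) F) := by
  refine isFourierTransform_iff.2 ⟨E.memLp_dil hμ n h.1, E.memLp_dil hμ (-n) h.2.1, ?_⟩
  have hpos : 0 < ‖E.𝔭 ^ (-n)‖ := norm_pos_iff.2 (zpow_ne_zero _ E.prime_ne_zero)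
  have hT : Tendsto (fun N : ℕ => ‖E.𝔭 ^ (-n)‖ * N) atTop atTop :=
    tendsto_natCast_atTop_atTop.const_mul_atTop hpos
  refine ((h.tendsto_real hμ).comp hT).congr fun N => ?_
  have e : (closedBall (0 : K) N).indicator (E.dil n f) =
      E.dil n ((closedBall (0 : K) (‖E.𝔭 ^ (-n)‖ * N)).indicator f) := by
    funext x
    have h2 : E.𝔭 ^ (-n) * x ∈ closedBall (0 : K) (‖E.𝔭 ^ (-n)‖ * N) ↔
        x ∈ closedBall (0 : K) (N : ℝ) := by
      rw [mem_closedBall_zero_iff, mem_closedBall_zero_iff, norm_mul,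
        mul_le_mul_iff_right₀ hpos]
    rw [LocalFieldData.dil]
    by_cases hx : x ∈ closedBall (0 : K) (N : ℝ)
    · rw [Set.indicator_of_mem hx, Set.indicator_of_mem (h2.2 hx), LocalFieldData.dil]
    · rw [Set.indicator_of_notMem hx, Set.indicator_of_notMem (fun hx' => hx (h2.1 hx')), mul_zero]
  rw [e, E.ft_dil hμ]
  simp only [Function.comp]
  rw [← E.eLpNorm_dil hμ (-n)]
  congr 1
  funext ξ
  simp only [LocalFieldData.dil, mul_sub]

end FourierTransform

/-! ### Test functions and bracket products -/

section Bracket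

variable {K : Type*} [NontriviallyNormedField K] {p c : ℕ} (E : LocalFieldData K p c)
  [hp : Fact p.Prime] [IsUltrametricDist K] [ProperSpace K] [MeasurableSpace K] [BorelSpace K]
  (μ : Measure K) [μ.IsAddHaarMeasure]

/-- Test functions: square integrable functions of bounded support whose Fourier integral has
bounded support. -/
def IsTest (f : K → ℂ) : Prop :=
  MemLp f 2 μ ∧ ∃ R : ℝ, (∀ x, R < ‖x‖ → f x = 0) ∧ ∀ ξ, R < ‖ξ‖ → E.ft μ f ξ = 0

variable {E μ}

lemma IsTest.isFourierTransform (hμ : μ (closedBall (0 : K) 1) = 1) {f : K → ℂ}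
    (h : E.IsTest μ f) : E.IsFourierTransform μ f (E.ft μ f) := by
  obtain ⟨hf, R, hR, -⟩ := h
  exact isFourierTransform_ft hμ hf hR

lemma IsTest.continuous_ft {f : K → ℂ} (h : E.IsTest μ f) : Continuous (E.ft μ f) := by
  obtain ⟨hf, R, hR, -⟩ := h
  exact E.continuous_ft μ (integrable_of_support hf hR)

lemma IsTest.add {f g : K → ℂ} (hf : E.IsTest μ f) (hg : E.IsTest μ g) :
    E.IsTest μ (fun x => f x + g x) := by
  obtain ⟨hf, R, hR, hR'⟩ := hf
  obtain ⟨hg, S, hS, hS'⟩ := hg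
  refine ⟨hf.add hg, max R S, fun x hx => ?_, fun ξ hξ => ?_⟩
  · simp only [hR x ((le_max_left R S).trans_lt hx), hS x ((le_max_right R S).trans_lt hx),
      add_zero]
  · rw [E.ft_add μ (integrable_of_support hf hR) (integrable_of_support hg hS),
      hR' ξ ((le_max_left R S).trans_lt hξ), hS' ξ ((le_max_right R S).trans_lt hξ), add_zero]

lemma IsTest.const_mul {f : K → ℂ} (hf : E.IsTest μ f) (a : ℂ) :
    E.IsTest μ (fun x => a * f x) := by
  obtain ⟨hf, R, hR, hR'⟩ := hf
  refine ⟨hf.const_mul a, R, fun x hx => by simp only [hR x hx, mul_zero], fun ξ hξ => ?_⟩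
  rw [E.ft_const_mul, hR' ξ hξ, mul_zero]

variable (E) in
lemma dil_support (n : ℤ) {f : K → ℂ} {R : ℝ} (h : ∀ x, R < ‖x‖ → f x = 0) (x : K)
    (hx : ‖E.𝔭‖ ^ n * R < ‖x‖) : E.dil n f x = 0 := by
  rw [dil, h, mul_zero]
  rwa [norm_mul, norm_zpow, zpow_neg, ← div_eq_inv_mul, lt_div_iff₀' (zpow_pos E.norm_prime_pos n)]

lemma IsTest.dil (hμ : μ (closedBall (0 : K) 1) = 1) {f : K → ℂ} (hf : E.IsTest μ f) (n : ℤ) :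
    E.IsTest μ (E.dil n f) := by
  obtain ⟨hf, R, hR, hR'⟩ := hf
  refine ⟨E.memLp_dil hμ n hf, max (‖E.𝔭‖ ^ n * R) (‖E.𝔭‖ ^ (-n) * R), fun x hx => ?_,
    fun ξ hξ => ?_⟩
  · exact E.dil_support n hR x ((le_max_left _ _).trans_lt hx)
  · rw [E.ft_dil hμ]
    exact E.dil_support (-n) hR' ξ ((le_max_right _ _).trans_lt hξ)

variable (E) in
/-- The bracket product `∑ₗ F(ξ + u(l)) conj (H(ξ + u(l)))`. It is used for boundedly supported
`F`, for which the sum is finite. -/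
noncomputable def bracket (F H : K → ℂ) (ξ : K) : ℂ :=
  ∑' l, F (ξ + E.u l) * conj (H (ξ + E.u l))

lemma eq_zero_of_norm_u_gt {F : K → ℂ} {R : ℝ} (h : ∀ x, R < ‖x‖ → F x = 0) {ξ : K}
    (hξ : ‖ξ‖ ≤ 1) {l : ℕ} (hl : max R 1 < ‖E.u l‖) : F (ξ + E.u l) = 0 := by
  refine h _ ?_
  by_contra! hle
  have := norm_sub_le_of_le (hle.trans (le_max_left R 1)) (hξ.trans (le_max_right R 1))
  rw [add_sub_cancel_left] at this
  exact hl.not_ge this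

variable (E) in
lemma exists_bracket_eq_sum (R : ℝ) : ∃ N₀ : ℕ, ∀ N, N₀ ≤ N → ∀ F H : K → ℂ,
    (∀ x, R < ‖x‖ → F x = 0) → ∀ ξ ∈ closedBall (0 : K) 1,
      E.bracket F H ξ = ∑ l ∈ Finset.range N, F (ξ + E.u l) * conj (H (ξ + E.u l)) := by
  obtain ⟨N₀, hN₀⟩ := E.exists_forall_norm_u_gt (max R 1)
  refine ⟨N₀, fun N hN F H h ξ hξ => tsum_eq_sum fun l hl => ?_⟩
  rw [eq_zero_of_norm_u_gt h (mem_closedBall_zero_iff.1 hξ) (hN₀ l (hN.trans (by simpa using hl))),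
    zero_mul]

lemma summable_bracket {F : K → ℂ} (H : K → ℂ) {R : ℝ} (h : ∀ x, R < ‖x‖ → F x = 0) {ξ : K}
    (hξ : ‖ξ‖ ≤ 1) : Summable fun l => F (ξ + E.u l) * conj (H (ξ + E.u l)) := by
  obtain ⟨N₀, hN₀⟩ := E.exists_forall_norm_u_gt (max R 1)
  refine summable_of_ne_finset_zero (s := Finset.range N₀) fun l hl => ?_
  rw [eq_zero_of_norm_u_gt h hξ (hN₀ l (by simpa using hl)), zero_mul]

lemma ae_comp_add {P : K → Prop} (h : ∀ᵐ x ∂μ, P x) (y : K) : ∀ᵐ x ∂μ, P (x + y) :=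
  (measurePreserving_add_right μ y).quasiMeasurePreserving.ae h

variable (E) in
lemma ae_comp_zpow_mul (hμ : μ (closedBall (0 : K) 1) = 1) {P : K → Prop} (h : ∀ᵐ x ∂μ, P x)
    (n : ℤ) : ∀ᵐ x ∂μ, P (E.𝔭 ^ n * x) :=
  (E.quasiMeasurePreserving_zpow_mul hμ n).ae h

variable (E) in
lemma bracket_congr (F : K → ℂ) {H H' : K → ℂ} (h : H =ᵐ[μ] H') :
    E.bracket F H =ᵐ[μ] E.bracket F H' := by
  filter_upwards [ae_all_iff.2 fun l => ae_comp_add h (E.u l)] with ξ hξ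
  simp_rw [bracket, hξ]

lemma IsTest.memLp_mul {f H : K → ℂ} (hf : E.IsTest μ f) (hH : MemLp H 2 μ) :
    MemLp (fun ξ => E.ft μ f ξ * conj (H ξ)) 2 μ := by
  refine hH.of_le_mul (c := ∫ x, ‖f x‖ ∂μ)
    (hf.continuous_ft.aestronglyMeasurable.mul
      (Complex.continuous_conj.comp_aestronglyMeasurable hH.1))
    (ae_of_all _ fun x => ?_)
  rw [norm_mul, RCLike.norm_conj]
  exact mul_le_mul_of_nonneg_right (E.norm_ft_le μ f x) (norm_nonneg _)

lemma IsTest.memLp_bracket {f H : K → ℂ} (hf : E.IsTest μ f) (hH : MemLp H 2 μ) :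
    MemLp (E.bracket (E.ft μ f) H) 2 (μ.restrict (closedBall 0 1)) := by
  obtain ⟨R, -, hR⟩ := hf.2
  obtain ⟨N, hN⟩ := E.exists_bracket_eq_sum R
  have h1 : MemLp (fun ξ => ∑ l ∈ Finset.range N,
      E.ft μ f (ξ + E.u l) * conj (H (ξ + E.u l))) 2 (μ.restrict (closedBall 0 1)) :=
    memLp_finsetSum _ fun l _ => ((hf.memLp_mul hH).comp_measurePreserving
      (measurePreserving_add_right μ (E.u l))).restrict _
  refine (memLp_congr_ae ?_).1 h1
  filter_upwards [ae_restrict_mem measurableSet_closedBall] with ξ hξ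
  rw [hN N le_rfl _ H hR ξ hξ]

/-- The inner products with the translates `h(x - u(k))` are the Fourier coefficients of the
bracket product. -/
lemma IsTest.integral_mul_conj_comp_sub (hμ : μ (closedBall (0 : K) 1) = 1) {f h H : K → ℂ}
    (hf : E.IsTest μ f) (hh : E.IsFourierTransform μ h H) (k : ℕ) :
    ∫ x, f x * conj (h (x - E.u k)) ∂μ =
      ∫ ξ in closedBall 0 1, E.bracket (E.ft μ f) H ξ * (E.χ (E.u k * ξ) : ℂ) ∂μ := by
  rw [(hf.isFourierTransform hμ).integral_mul_conj hμ (hh.comp_sub (E.u k))]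
  obtain ⟨R, -, hR⟩ := hf.2
  obtain ⟨N₁, hN₁⟩ := E.exists_bracket_eq_sum R
  obtain ⟨N₂, hN₂⟩ := E.exists_integral_eq_sum μ R
  set N := max N₁ N₂
  set G : K → ℂ := fun ξ => E.ft μ f ξ * conj (H ξ) with hG
  have hGi : Integrable G μ := integrable_of_support (hf.memLp_mul hh.2.1)
    (R := R) fun x hx => by simp only [hG, hR x hx, zero_mul]
  have e1 : ∀ ξ, E.ft μ f ξ * conj (conj (E.χ (E.u k * ξ) : ℂ) * H ξ) =
      G ξ * (E.χ (E.u k * ξ) : ℂ) := fun ξ => by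
    rw [map_mul, Complex.conj_conj, hG]; ring
  simp_rw [e1]
  rw [hN₂ N (le_max_right _ _) _ (E.integrable_mul_χ hGi (E.u k))
    (fun x hx => by simp only [hG, hR x hx, zero_mul])]
  simp_rw [E.χ_u_mul_add_u]
  rw [← integral_finsetSum]
  · refine setIntegral_congr_fun measurableSet_closedBall fun ξ hξ => ?_
    rw [hN₁ N (le_max_left _ _) _ H hR ξ hξ, Finset.sum_mul]
  · intro l _
    refine E.integrable_mul_χ ?_ _
    exact (((measurePreserving_add_right μ (E.u l)).integrable_comp_of_integrable hGi)).restrict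

/-- Parseval for the system of translates, in terms of bracket products. -/
lemma IsTest.hasSum_translates (hμ : μ (closedBall (0 : K) 1) = 1) {f g h h' H H' : K → ℂ}
    (hf : E.IsTest μ f) (hg : E.IsTest μ g) (hh : E.IsFourierTransform μ h H)
    (hh' : E.IsFourierTransform μ h' H') :
    HasSum (fun k : ℕ => (∫ x, f x * conj (h (x - E.u k)) ∂μ) *
        conj (∫ x, g x * conj (h' (x - E.u k)) ∂μ))
      (∫ ξ in closedBall 0 1, E.bracket (E.ft μ f) H ξ *
        conj (E.bracket (E.ft μ g) H' ξ) ∂μ) := by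
  simp_rw [hf.integral_mul_conj_comp_sub hμ hh, hg.integral_mul_conj_comp_sub hμ hh']
  exact E.hasSum_parseval_conj hμ (hf.memLp_bracket hh.2.1) (hg.memLp_bracket hh'.2.1)

lemma tsum_eq_sum_tsum_digit {G : ℕ → ℂ} (hG : Summable G) {q : ℕ} (hq : 0 < q) :
    ∑' l, G l = ∑ r ∈ Finset.range q, ∑' n, G (q * n + r) := by
  have : NeZero q := ⟨hq.ne'⟩
  have hG' : Summable fun x : ℕ × Fin q => G (q * x.1 + x.2) := by
    refine ((Nat.divModEquiv q).symm.summable_iff.2 hG).congr fun x => ?_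
    simp [Nat.divModEquiv, mul_comm]
  rw [← (Nat.divModEquiv q).symm.tsum_eq G]
  have e : ∀ x : ℕ × Fin q, G ((Nat.divModEquiv q).symm x) = G (q * x.1 + x.2) := fun x => by
    simp [Nat.divModEquiv, mul_comm]
  simp_rw [e]
  have hG'' := (Equiv.prodComm (Fin q) ℕ).summable_iff.2 hG'
  rw [← (Equiv.prodComm (Fin q) ℕ).tsum_eq, Finset.sum_range (fun r => ∑' n, G (q * n + r)),
    ← tsum_fintype (L := .unconditional _)]
  exact hG''.tsum_prod

/-- The refinement relation for bracket products. The coset decomposition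
`u(q n + r) = u(r) + 𝔭⁻¹ u(n)` separates the values of the periodic function `m`. -/
lemma bracket_refinement {F Φ m : K → ℂ} {R : ℝ} (h : ∀ x, R < ‖x‖ → F x = 0) {ξ : K}
    (hξ : ‖ξ‖ ≤ 1) (hm : ∀ r n : ℕ, m (E.𝔭 * ξ + E.𝔭 * E.u r + E.u n) = m (E.𝔭 * ξ + E.𝔭 * E.u r)) :
    E.bracket F (fun ξ => m (E.𝔭 * ξ) * Φ (E.𝔭 * ξ)) ξ =
      (Real.sqrt ((p : ℝ) ^ c) : ℂ)⁻¹ * ∑ r ∈ Finset.range (p ^ c),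
        conj (m (E.𝔭 * ξ + E.𝔭 * E.u r)) * E.bracket (E.dil 1 F) Φ (E.𝔭 * ξ + E.𝔭 * E.u r) := by
  have hs : (Real.sqrt ((p : ℝ) ^ c) : ℂ) ≠ 0 := by simpa using E.sqrt_q_zpow_ne 1
  rw [bracket, tsum_eq_sum_tsum_digit
    (summable_bracket (fun ξ => m (E.𝔭 * ξ) * Φ (E.𝔭 * ξ)) h hξ) E.q_pos, Finset.mul_sum]
  refine Finset.sum_congr rfl fun r hr => ?_
  rw [bracket, ← mul_assoc, ← tsum_mul_left]
  refine tsum_congr fun n => ?_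
  have e1 : E.𝔭 * (ξ + E.u (p ^ c * n + r)) = E.𝔭 * ξ + E.𝔭 * E.u r + E.u n := by
    rw [E.u_mul_add n (Finset.mem_range.1 hr)]
    field_simp [E.prime_ne_zero]
    ring
  have e2 : E.𝔭 ^ (-1 : ℤ) * (E.𝔭 * ξ + E.𝔭 * E.u r + E.u n) = ξ + E.u (p ^ c * n + r) := by
    rw [← e1, zpow_neg_one, inv_mul_cancel_left₀ E.prime_ne_zero]
  rw [dil, e2, e1, hm r n, zpow_one, map_mul]
  field_simp

/-- Summing the bracket products of the generators reduces, by the orthogonality relations of the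
masks on the cosets of `𝔭 𝔇`, to the bracket product of the refinable functions one level up. -/
lemma IsTest.sum_integral_bracket (hμ : μ (closedBall (0 : K) 1) = 1) {ι : Type*} [Fintype ι]
    {f g Φ Φ' : K → ℂ} (hf : E.IsTest μ f) (hg : E.IsTest μ g) (hΦ : MemLp Φ 2 μ)
    (hΦ' : MemLp Φ' 2 μ) {m m' Ψ Ψ' : ι → K → ℂ} (hΨ : ∀ ℓ, MemLp (Ψ ℓ) 2 μ)
    (hΨ' : ∀ ℓ, MemLp (Ψ' ℓ) 2 μ)
    (hm : ∀ ℓ, ∀ n : ℕ, ∀ᵐ ξ ∂μ, m ℓ (ξ + E.u n) = m ℓ ξ)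
    (hm' : ∀ ℓ, ∀ n : ℕ, ∀ᵐ ξ ∂μ, m' ℓ (ξ + E.u n) = m' ℓ ξ)
    (hΨm : ∀ ℓ, Ψ ℓ =ᵐ[μ] fun ξ => m ℓ (E.𝔭 * ξ) * Φ (E.𝔭 * ξ))
    (hΨm' : ∀ ℓ, Ψ' ℓ =ᵐ[μ] fun ξ => m' ℓ (E.𝔭 * ξ) * Φ' (E.𝔭 * ξ)) (κ : ℂ)
    (horth : ∀ r < p ^ c, ∀ s < p ^ c, ∀ᵐ ξ ∂μ,
      ∑ ℓ, conj (m ℓ (ξ + E.𝔭 * E.u r)) * m' ℓ (ξ + E.𝔭 * E.u s) = if r = s then κ else 0) :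
    ∑ ℓ, ∫ ξ in closedBall 0 1, E.bracket (E.ft μ f) (Ψ ℓ) ξ *
        conj (E.bracket (E.ft μ g) (Ψ' ℓ) ξ) ∂μ =
      κ * ∫ ξ in closedBall 0 1, E.bracket (E.dil 1 (E.ft μ f)) Φ ξ *
        conj (E.bracket (E.dil 1 (E.ft μ g)) Φ' ξ) ∂μ := by
  have hft : ∀ {f : K → ℂ}, E.dil 1 (E.ft μ f) = E.ft μ (E.dil (-1) f) := by
    intro f; rw [E.ft_dil hμ, neg_neg]
  set A := E.bracket (E.dil 1 (E.ft μ f)) Φ with hA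
  set B := E.bracket (E.dil 1 (E.ft μ g)) Φ' with hB
  have hAL : MemLp A 2 (μ.restrict (closedBall 0 1)) := by
    rw [hA, hft]; exact (hf.dil hμ (-1)).memLp_bracket hΦ
  have hBL : MemLp B 2 (μ.restrict (closedBall 0 1)) := by
    rw [hB, hft]; exact (hg.dil hμ (-1)).memLp_bracket hΦ'
  have hAB : IntegrableOn (fun ξ => A ξ * conj (B ξ)) (closedBall 0 1) μ :=
    hAL.integrable_mul hBL.star
  have hint : ∀ ℓ, IntegrableOn (fun ξ => E.bracket (E.ft μ f) (Ψ ℓ) ξ *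
      conj (E.bracket (E.ft μ g) (Ψ' ℓ) ξ)) (closedBall 0 1) μ := fun ℓ =>
    (hf.memLp_bracket (hΨ ℓ)).integrable_mul (hg.memLp_bracket (hΨ' ℓ)).star
  rw [← integral_finsetSum _ fun ℓ _ => hint ℓ]
  -- pull the almost everywhere relations back along `ξ ↦ 𝔭 ξ` and `ξ ↦ 𝔭 ξ + 𝔭 u(r)`
  have hpull : ∀ {P : K → Prop}, (∀ᵐ ξ ∂μ, P ξ) → ∀ᵐ ξ ∂μ, P (E.𝔭 * ξ) := fun h => by
    simpa using E.ae_comp_zpow_mul hμ h 1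
  have hper : ∀ {m : K → ℂ}, (∀ n : ℕ, ∀ᵐ ξ ∂μ, m (ξ + E.u n) = m ξ) → ∀ᵐ ξ ∂μ, ∀ r n : ℕ,
      m (E.𝔭 * ξ + E.𝔭 * E.u r + E.u n) = m (E.𝔭 * ξ + E.𝔭 * E.u r) := fun h =>
    ae_all_iff.2 fun r => ae_all_iff.2 fun n => hpull (ae_comp_add (h n) (E.𝔭 * E.u r))
  obtain ⟨R, -, hR⟩ := hf.2
  obtain ⟨S, -, hS⟩ := hg.2
  have hs : (Real.sqrt ((p : ℝ) ^ c) : ℂ) ≠ 0 := by simpa using E.sqrt_q_zpow_ne 1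
  have hs2 : (Real.sqrt ((p : ℝ) ^ c) : ℂ) ^ 2 = (p : ℂ) ^ c := by simpa using E.sqrt_q_zpow_sq 1
  have hmain : ∀ᵐ ξ ∂μ.restrict (closedBall 0 1),
      ∑ ℓ, E.bracket (E.ft μ f) (Ψ ℓ) ξ * conj (E.bracket (E.ft μ g) (Ψ' ℓ) ξ) =
        ∑ r ∈ Finset.range (p ^ c), (κ * ((p : ℂ) ^ c)⁻¹) *
          (A (E.𝔭 * ξ + E.𝔭 * E.u r) * conj (B (E.𝔭 * ξ + E.𝔭 * E.u r))) := by
    have horth' : ∀ᵐ ξ ∂μ, ∀ r ∈ Finset.range (p ^ c), ∀ s ∈ Finset.range (p ^ c),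
        ∑ ℓ, conj (m ℓ (E.𝔭 * ξ + E.𝔭 * E.u r)) * m' ℓ (E.𝔭 * ξ + E.𝔭 * E.u s) =
          if r = s then κ else 0 := by
      refine hpull (P := fun ξ => ∀ r ∈ Finset.range (p ^ c), ∀ s ∈ Finset.range (p ^ c),
        ∑ ℓ, conj (m ℓ (ξ + E.𝔭 * E.u r)) * m' ℓ (ξ + E.𝔭 * E.u s) = if r = s then κ else 0) ?_
      refine (Finset.eventually_all _).2 fun r hr => (Finset.eventually_all _).2 fun s hs => ?_
      exact horth r (Finset.mem_range.1 hr) s (Finset.mem_range.1 hs)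
    filter_upwards [ae_restrict_mem measurableSet_closedBall, ae_restrict_of_ae horth',
      ae_restrict_of_ae (ae_all_iff.2 fun ℓ => hper (hm ℓ)),
      ae_restrict_of_ae (ae_all_iff.2 fun ℓ => hper (hm' ℓ)),
      ae_restrict_of_ae (ae_all_iff.2 fun ℓ => E.bracket_congr (E.ft μ f) (hΨm ℓ)),
      ae_restrict_of_ae (ae_all_iff.2 fun ℓ => E.bracket_congr (E.ft μ g) (hΨm' ℓ))]
      with ξ hξ h1 h2 h3 h4 h5
    rw [mem_closedBall_zero_iff] at hξ
    have e : ∀ ℓ, E.bracket (E.ft μ f) (Ψ ℓ) ξ * conj (E.bracket (E.ft μ g) (Ψ' ℓ) ξ) =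
        ((p : ℂ) ^ c)⁻¹ * ∑ r ∈ Finset.range (p ^ c), ∑ s ∈ Finset.range (p ^ c),
          (A (E.𝔭 * ξ + E.𝔭 * E.u r) * conj (B (E.𝔭 * ξ + E.𝔭 * E.u s))) *
            (conj (m ℓ (E.𝔭 * ξ + E.𝔭 * E.u r)) * m' ℓ (E.𝔭 * ξ + E.𝔭 * E.u s)) := by
      intro ℓ
      rw [h4 ℓ, h5 ℓ, bracket_refinement hR hξ (h2 ℓ), bracket_refinement hS hξ (h3 ℓ), map_mul,
        map_sum, mul_mul_mul_comm, Finset.sum_mul_sum, ← hs2]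
      congr 1
      · rw [map_inv₀, Complex.conj_ofReal, ← mul_inv, pow_two]
      · refine Finset.sum_congr rfl fun r _ => Finset.sum_congr rfl fun s _ => ?_
        rw [map_mul, Complex.conj_conj]
        ring
    simp_rw [e]
    rw [← Finset.mul_sum, Finset.sum_comm, Finset.mul_sum]
    refine Finset.sum_congr rfl fun r hr => ?_
    rw [Finset.sum_comm]
    simp_rw [← Finset.mul_sum]
    rw [Finset.sum_congr rfl fun s hs => by rw [h1 r hr s hs]]
    simp only [mul_ite, mul_zero, Finset.sum_ite_eq, hr, if_true]
    ring
  rw [integral_congr_ae hmain, integral_finsetSum]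
  · simp_rw [integral_const_mul]
    rw [← Finset.mul_sum, E.sum_integral_prime_mul hμ hAB, mul_assoc,
      ← mul_assoc _ _ (∫ _ in _, _ ∂_),
      inv_mul_cancel₀ (by rw [← hs2]; exact pow_ne_zero _ hs), one_mul]
  · intro r hr
    exact (E.integrableOn_comp_prime_mul hμ hAB (Finset.mem_range.1 hr)).const_mul _

end Bracket

/-! ### Masks and refinable functions -/

section Masks

variable {K : Type*} [NontriviallyNormedField K] {p c : ℕ} {E : LocalFieldData K p c}
  [hp : Fact p.Prime] [IsUltrametricDist K] [ProperSpace K] [MeasurableSpace K] [BorelSpace K]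
  {μ : Measure K} [μ.IsAddHaarMeasure]

lemma ae_of_ae_restrict_closedBall {P : K → Prop} (n₀ : ℕ)
    (h : ∀ n : ℕ, n₀ ≤ n → ∀ᵐ x ∂μ.restrict (closedBall 0 n), P x) : ∀ᵐ x ∂μ, P x := by
  have h1 : ∀ᵐ x ∂μ, ∀ n : ℕ, n₀ ≤ n → x ∈ closedBall (0 : K) n → P x := by
    rw [ae_all_iff]
    intro n
    by_cases hn : n₀ ≤ n
    · filter_upwards [(ae_restrict_iff' measurableSet_closedBall).1 (h n hn)] with x hx _
      exact hx
    · exact ae_of_all _ fun x hx => absurd hx hn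
  filter_upwards [h1] with x hx
  refine hx (max n₀ ⌈‖x‖⌉₊) (le_max_left _ _) ?_
  rw [mem_closedBall_zero_iff]
  exact (Nat.le_ceil _).trans (Nat.cast_le.2 (le_max_right _ _))

variable (E) in
/-- The partial sums of the mask series. -/
noncomputable def maskSum (a : ℕ → ℂ) (N : ℕ) (ξ : K) : ℂ :=
  (Real.sqrt ((p : ℝ) ^ c) : ℂ)⁻¹ * ∑ k ∈ Finset.range N, a k * conj (E.χ (E.u k * ξ) : ℂ)

lemma continuous_maskSum (a : ℕ → ℂ) (N : ℕ) : Continuous (E.maskSum a N) :=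
  continuous_const.mul (continuous_finsetSum _ fun _ _ =>
    continuous_const.mul (E.continuous_conj_χ_mul _))

lemma maskSum_add_u (a : ℕ → ℂ) (N n : ℕ) (ξ : K) :
    E.maskSum a N (ξ + E.u n) = E.maskSum a N ξ := by
  simp_rw [maskSum, E.χ_u_mul_add_u]

/-- A mask is periodic with respect to the lattice `{u(n)}`. -/
lemma IsMask.ae_add_u {a : ℕ → ℂ} {m : K → ℂ} (h : E.IsMask μ a m) (n : ℕ) :
    ∀ᵐ ξ ∂μ, m (ξ + E.u n) = m ξ := by
  refine ae_of_ae_restrict_closedBall ⌈‖E.u n‖⌉₊ fun R hR => ?_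
  have hu : ‖E.u n‖ ≤ R := (Nat.le_ceil _).trans (Nat.cast_le.2 hR)
  set ν := μ.restrict (closedBall (0 : K) R)
  have hT : MeasurePreserving (fun x => x + E.u n) ν ν := by
    have := (measurePreserving_add_right μ (E.u n)).restrict_preimage
      (measurableSet_closedBall (x := (0 : K)) (ε := (R : ℝ)))
    rwa [preimage_add_closedBall hu] at this
  have hmν : AEStronglyMeasurable m ν := h.1.restrict
  have hlim : Tendsto (fun N => eLpNorm (fun ξ => m ξ - E.maskSum a N ξ) 2 ν) atTop (𝓝 0) := h.2 R
  have hS : ∀ N, AEStronglyMeasurable (E.maskSum a N) ν := fun N =>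
    (continuous_maskSum a N).aestronglyMeasurable
  -- the partial sums are periodic, and translation by `u(n)` preserves the ball of radius `R`
  have hle : ∀ N, eLpNorm (fun ξ => m (ξ + E.u n) - m ξ) 2 ν ≤
      eLpNorm (fun ξ => m ξ - E.maskSum a N ξ) 2 ν +
        eLpNorm (fun ξ => m ξ - E.maskSum a N ξ) 2 ν := by
    intro N
    have e : (fun ξ => m (ξ + E.u n) - m ξ) =
        ((fun ξ => m ξ - E.maskSum a N ξ) ∘ fun ξ => ξ + E.u n) -
          fun ξ => m ξ - E.maskSum a N ξ := by
      funext ξ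
      simp only [Pi.sub_apply, Function.comp, maskSum_add_u]
      ring
    have hd : AEStronglyMeasurable (fun ξ => m ξ - E.maskSum a N ξ) ν := hmν.sub (hS N)
    rw [e]
    refine (eLpNorm_sub_le (hd.comp_measurePreserving hT) hd one_le_two).trans (le_of_eq ?_)
    rw [eLpNorm_comp_measurePreserving hd hT]
  have h0 : eLpNorm (fun ξ => m (ξ + E.u n) - m ξ) 2 ν = 0 := by
    have h2 := hlim.add hlim
    rw [add_zero] at h2
    exact le_antisymm (ge_of_tendsto' h2 hle) zero_le
  have hd : AEStronglyMeasurable (fun ξ => m (ξ + E.u n) - m ξ) ν :=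
    (hmν.comp_measurePreserving hT).sub hmν
  rw [eLpNorm_eq_zero_iff hd two_ne_zero] at h0
  filter_upwards [h0] with ξ hξ
  exact sub_eq_zero.1 hξ

/-- The refinement equation on the Fourier side. -/
lemma IsRefinable.ae_eq (hμ : μ (closedBall (0 : K) 1) = 1) {a : ℕ → ℂ} {φ Φ m : K → ℂ}
    (hφ : E.IsRefinable μ a φ) (hm : E.IsMask μ a m) (hΦ : E.IsFourierTransform μ φ Φ) :
    Φ =ᵐ[μ] fun ξ => m (E.𝔭 * ξ) * Φ (E.𝔭 * ξ) := by
  have hs : (Real.sqrt ((p : ℝ) ^ c) : ℂ) ≠ 0 := by simpa using E.sqrt_q_zpow_ne 1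
  have hFT : ∀ N, E.IsFourierTransform μ
      (fun x => (Real.sqrt ((p : ℝ) ^ c) : ℂ) *
        ∑ k ∈ Finset.range N, a k * φ (E.𝔭⁻¹ * x - E.u k))
      (fun ξ => E.maskSum a N (E.𝔭 * ξ) * Φ (E.𝔭 * ξ)) := by
    intro N
    have := IsFourierTransform.sum (Finset.range N) fun k _ =>
      ((hΦ.comp_sub (E.u k)).dil hμ 1).const_mul (a k)
    convert this using 1
    · funext x
      rw [Finset.mul_sum]
      refine Finset.sum_congr rfl fun k _ => ?_
      rw [LocalFieldData.dil, zpow_one, zpow_neg_one]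
      ring
    · funext ξ
      rw [maskSum, Finset.mul_sum, Finset.sum_mul]
      refine Finset.sum_congr rfl fun k _ => ?_
      rw [LocalFieldData.dil, neg_neg, zpow_one, zpow_neg_one, Complex.ofReal_inv]
      ring
  have hlim : Tendsto (fun N => eLpNorm
      ((fun ξ => E.maskSum a N (E.𝔭 * ξ) * Φ (E.𝔭 * ξ)) - Φ) 2 μ) atTop (𝓝 0) := by
    refine hφ.2.congr fun N => ?_
    rw [← (hΦ.sub (hFT N)).eLpNorm_eq hμ, ← eLpNorm_neg]
    congr 1
    funext ξ
    simp
  have hmeas : ∀ N, AEStronglyMeasurable (fun ξ => E.maskSum a N (E.𝔭 * ξ) * Φ (E.𝔭 * ξ)) μ :=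
    fun N => (hFT N).2.1.1
  refine ae_of_ae_restrict_closedBall 0 fun R _ => ?_
  -- along a subsequence both sequences converge almost everywhere
  have hmask : Tendsto (fun N => eLpNorm (E.maskSum a N - m) 2 (μ.restrict (closedBall (0 : K) R)))
      atTop (𝓝 0) := by
    refine (hm.2 R).congr fun N => ?_
    rw [← eLpNorm_neg]
    congr 1
    funext ξ
    simp [maskSum]
  obtain ⟨ns, hns, hae⟩ := (tendstoInMeasure_of_tendsto_eLpNorm two_ne_zero
    (fun N => (continuous_maskSum a N).aestronglyMeasurable) hm.1.restrict
    hmask).exists_seq_tendsto_ae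
  obtain ⟨ms, hms, hae'⟩ := (tendstoInMeasure_of_tendsto_eLpNorm two_ne_zero
    (fun N => hmeas (ns N)) hΦ.2.1.1 (hlim.comp hns.tendsto_atTop)).exists_seq_tendsto_ae
  have hae2 := E.ae_comp_zpow_mul hμ ((ae_restrict_iff' measurableSet_closedBall).1 hae) 1
  rw [ae_restrict_iff' measurableSet_closedBall]
  filter_upwards [hae2, hae'] with ξ h1 h2 hξ
  rw [zpow_one] at h1
  have hmem : E.𝔭 * ξ ∈ closedBall (0 : K) R := by
    rw [mem_closedBall_zero_iff] at hξ ⊢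
    rw [norm_mul]
    exact (mul_le_of_le_one_left (norm_nonneg _) E.norm_prime_lt_one.le).trans hξ
  have h3 := ((h1 hmem).comp hms.tendsto_atTop).mul_const (Φ (E.𝔭 * ξ))
  exact tendsto_nhds_unique h2 h3

/-- The relations `M_k* M_k' = κ I` for all `k` say that the columns `(m_ℓ(ξ + 𝔭 u(r)))_ℓ`,
`r < q`, are orthogonal to the corresponding columns of `m'`, with inner products `κ` on the
diagonal. -/
lemma ae_sum_conj_mul_eq {ι : Type*} [Fintype ι] {m m' : ι → K → ℂ} (κ : ℂ)
    (h : ∀ k : ℕ, 1 ≤ k → k < p ^ c → ∀ᵐ ξ ∂μ,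
      (maskMatrix m (E.𝔭 * E.u k) ξ)ᴴ * maskMatrix m' (E.𝔭 * E.u k) ξ = κ • 1)
    (r : ℕ) (hr : r < p ^ c) (s : ℕ) (hs : s < p ^ c) :
    ∀ᵐ ξ ∂μ, ∑ ℓ, conj (m ℓ (ξ + E.𝔭 * E.u r)) * m' ℓ (ξ + E.𝔭 * E.u s) =
      if r = s then κ else 0 := by
  have h00 : ∀ᵐ ξ ∂μ, ∑ ℓ, conj (m ℓ ξ) * m' ℓ ξ = κ := by
    filter_upwards [h 1 le_rfl E.one_lt_q] with ξ hξ
    simpa [Matrix.mul_apply, maskMatrix] using congrFun (congrFun hξ 0) 0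
  by_cases hrs : r = s
  · subst hrs
    simpa using ae_comp_add h00 (E.𝔭 * E.u r)
  · obtain ⟨k, hk1, hk, hk'⟩ := E.exists_prime_mul_u_sub hr hs hrs
    have h01 : ∀ᵐ ξ ∂μ, ∑ ℓ, conj (m ℓ ξ) * m' ℓ (ξ + E.𝔭 * E.u k) = 0 := by
      filter_upwards [h k hk1 hk] with ξ hξ
      simpa [Matrix.mul_apply, maskMatrix] using congrFun (congrFun hξ 0) 1
    filter_upwards [ae_comp_add h01 (E.𝔭 * E.u r)] with ξ hξ
    rw [if_neg hrs, ← hξ, hk', add_assoc]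

lemma ae_norm_mask_le_one {ι : Type*} [Fintype ι] {m : ι → K → ℂ}
    (h : ∀ k : ℕ, 1 ≤ k → k < p ^ c → ∀ᵐ ξ ∂μ,
      (maskMatrix m (E.𝔭 * E.u k) ξ)ᴴ * maskMatrix m (E.𝔭 * E.u k) ξ = 1) (ℓ : ι) :
    ∀ᵐ ξ ∂μ, ‖m ℓ ξ‖ ≤ 1 := by
  have h0 := ae_sum_conj_mul_eq (E := E) (m := m) (m' := m) 1 (by simpa using h) 0 E.q_pos 0 E.q_pos
  filter_upwards [h0] with ξ hξ
  simp only [E.u_zero, mul_zero, add_zero, if_true] at hξ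
  simp_rw [mul_comm (conj _), Complex.mul_conj, Complex.normSq_eq_norm_sq] at hξ
  have h1 : ∑ ℓ, ‖m ℓ ξ‖ ^ 2 = 1 := by exact_mod_cast hξ
  have h2 : ‖m ℓ ξ‖ ^ 2 ≤ 1 := by
    rw [← h1]
    exact Finset.single_le_sum (f := fun ℓ => ‖m ℓ ξ‖ ^ 2) (fun _ _ => by positivity)
      (Finset.mem_univ ℓ)
  exact (sq_le_one_iff₀ (norm_nonneg _)).1 h2

/-- Iterating the refinement equation, `|Φ(ξ)| ≤ |Φ(𝔭ʲ ξ)| → 1`. -/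
lemma ae_norm_refinable_le_one (hμ : μ (closedBall (0 : K) 1) = 1) {Φ m : K → ℂ}
    (hΦ : Φ =ᵐ[μ] fun ξ => m (E.𝔭 * ξ) * Φ (E.𝔭 * ξ)) (hm : ∀ᵐ ξ ∂μ, ‖m ξ‖ ≤ 1)
    (hlim : ∀ᵐ ξ ∂μ, Tendsto (fun j : ℕ => ‖Φ (E.𝔭 ^ j * ξ)‖) atTop (𝓝 1)) :
    ∀ᵐ ξ ∂μ, ‖Φ ξ‖ ≤ 1 := by
  filter_upwards [hlim, ae_all_iff.2 fun j : ℕ => E.ae_comp_zpow_mul hμ hΦ j,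
    ae_all_iff.2 fun j : ℕ => E.ae_comp_zpow_mul hμ hm j] with ξ h1 h2 h3
  refine ge_of_tendsto' h1 fun j => ?_
  induction j with
  | zero => simp
  | succ j ih =>
    refine ih.trans ?_
    have e := h2 j
    have b := h3 (j + 1 : ℕ)
    simp only [zpow_natCast] at e b
    rw [← mul_assoc, ← pow_succ'] at e
    rw [e, norm_mul]
    exact mul_le_of_le_one_left (norm_nonneg _) b

/-- The dilations are unitary. -/
lemma integral_dil_mul_conj_dil (hμ : μ (closedBall (0 : K) 1) = 1) (n : ℤ) (f g : K → ℂ) :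
    ∫ x, E.dil n f x * conj (E.dil n g x) ∂μ = ∫ x, f x * conj (g x) ∂μ := by
  have e : ∀ x, E.dil n f x * conj (E.dil n g x) =
      ((p : ℂ) ^ c) ^ n * (fun y => f y * conj (g y)) (E.𝔭 ^ (-n) * x) := by
    intro x
    simp only [dil, map_mul, Complex.conj_ofReal]
    rw [← E.sqrt_q_zpow_sq]
    ring
  have hq : ((p : ℂ) ^ c) ≠ 0 := by have := hp.out.ne_zero; positivity
  simp_rw [e]
  rw [integral_const_mul, E.integral_zpow_mul hμ (-n) (fun y => f y * conj (g y)), ← mul_assoc,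
    ← zpow_add₀ hq, add_neg_cancel, zpow_zero, one_mul]

lemma integral_norm_sq_dil (hμ : μ (closedBall (0 : K) 1) = 1) (n : ℤ) (f : K → ℂ) :
    ∫ x, ‖E.dil n f x‖ ^ 2 ∂μ = ∫ x, ‖f x‖ ^ 2 ∂μ := by
  have := integral_dil_mul_conj_dil (E := E) hμ n f f
  rw [integral_mul_conj_self, integral_mul_conj_self] at this
  exact_mod_cast this

/-- At fine scales the bracket product has a single term, and the energy of the projection onto the
translates of the refinable function tends to the energy of `f`. -/
lemma IsTest.tendsto_energy_atTop (hμ : μ (closedBall (0 : K) 1) = 1) {f Φ : K → ℂ}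
    (hf : E.IsTest μ f) (hΦ : MemLp Φ 2 μ) (hle : ∀ᵐ ξ ∂μ, ‖Φ ξ‖ ≤ 1)
    (hlim : ∀ᵐ ξ ∂μ, Tendsto (fun j : ℕ => ‖Φ (E.𝔭 ^ j * ξ)‖) atTop (𝓝 1)) :
    Tendsto (fun j : ℕ => ∫ ξ in closedBall 0 1, ‖E.bracket (E.dil j (E.ft μ f)) Φ ξ‖ ^ 2 ∂μ)
      atTop (𝓝 (∫ x, ‖f x‖ ^ 2 ∂μ)) := by
  have hFT := hf.isFourierTransform hμ
  have hPl : ∫ x, ‖f x‖ ^ 2 ∂μ = ∫ ξ, ‖E.ft μ f ξ‖ ^ 2 ∂μ := by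
    have := hFT.integral_mul_conj hμ hFT
    rw [integral_mul_conj_self, integral_mul_conj_self] at this
    exact_mod_cast this
  have hFi : Integrable (fun ξ => ‖E.ft μ f ξ‖ ^ 2) μ :=
    (memLp_two_iff_integrable_sq_norm hFT.2.1.1).1 hFT.2.1
  obtain ⟨R, -, hR⟩ := hf.2
  have hmain : Tendsto (fun j : ℕ => ∫ ξ, ‖E.ft μ f ξ * conj (Φ (E.𝔭 ^ (j : ℤ) * ξ))‖ ^ 2 ∂μ)
      atTop (𝓝 (∫ ξ, ‖E.ft μ f ξ‖ ^ 2 ∂μ)) := by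
    refine tendsto_integral_of_dominated_convergence (fun ξ => ‖E.ft μ f ξ‖ ^ 2) (fun j => ?_) hFi
      (fun j => ?_) ?_
    · have : AEStronglyMeasurable (fun ξ => Φ (E.𝔭 ^ (j : ℤ) * ξ)) μ :=
        hΦ.1.comp_quasiMeasurePreserving (E.quasiMeasurePreserving_zpow_mul hμ j)
      exact (hFT.2.1.1.mul (Complex.continuous_conj.comp_aestronglyMeasurable this)).norm.pow 2
    · filter_upwards [E.ae_comp_zpow_mul hμ hle j] with ξ hξ
      rw [Real.norm_of_nonneg (by positivity), norm_mul, RCLike.norm_conj, mul_pow]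
      exact mul_le_of_le_one_right (by positivity) (pow_le_one₀ (norm_nonneg _) hξ)
    · filter_upwards [hlim] with ξ hξ
      have := (hξ.const_mul ‖E.ft μ f ξ‖).pow 2
      simpa [norm_mul] using this
  rw [hPl]
  refine hmain.congr' ?_
  have hsmall : ∀ᶠ j : ℕ in atTop, ‖E.𝔭‖ ^ j * R < 1 := by
    have := (tendsto_pow_atTop_nhds_zero_of_lt_one E.norm_prime_pos.le
      E.norm_prime_lt_one).mul_const R
    rw [zero_mul] at this
    exact this.eventually (gt_mem_nhds one_pos)
  filter_upwards [hsmall] with j hj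
  have hsupp : ∀ ξ : K, 1 < ‖ξ‖ → E.dil j (E.ft μ f) ξ = 0 := fun ξ hξ =>
    E.dil_support j hR ξ (by rw [zpow_natCast]; exact hj.trans hξ)
  have hdil : ∀ ξ, E.dil j (fun ξ => E.ft μ f ξ * conj (Φ (E.𝔭 ^ (j : ℤ) * ξ))) ξ =
      E.dil j (E.ft μ f) ξ * conj (Φ ξ) := by
    intro ξ
    rw [LocalFieldData.dil, LocalFieldData.dil, ← mul_assoc (E.𝔭 ^ (j : ℤ)), ← zpow_add₀
      E.prime_ne_zero, add_neg_cancel, zpow_zero, one_mul, mul_assoc]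
  rw [← integral_norm_sq_dil (E := E) hμ j]
  simp_rw [hdil]
  rw [← integral_indicator measurableSet_closedBall]
  refine integral_congr_ae (ae_of_all _ fun ξ => ?_)
  by_cases hξ : 1 < ‖ξ‖
  · rw [Set.indicator_of_notMem (by simpa using hξ)]
    simp [hsupp ξ hξ]
  · rw [not_lt] at hξ
    rw [Set.indicator_of_mem (by simpa using hξ), bracket, tsum_eq_single 0]
    · simp [E.u_zero]
    · intro l hl
      rw [hsupp, zero_mul]
      by_contra! hle
      have := norm_sub_le_of_le hle hξ
      rw [add_sub_cancel_left] at this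
      exact hl (E.u_inj_mod l 0 (by rwa [E.u_zero, sub_zero]))

lemma measure_closedBall_prime_pow (hμ : μ (closedBall (0 : K) 1) = 1) (j : ℕ) (R : ℝ) :
    μ (closedBall (0 : K) (‖E.𝔭‖ ^ j * R)) =
      ((((p : ℝ≥0) ^ c)⁻¹ ^ j : ℝ≥0) : ℝ≥0∞) * μ (closedBall (0 : K) R) := by
  have h := E.lintegral_zpow_mul hμ (-(j : ℤ)) ((closedBall (0 : K) R).indicator 1)
  have e : ∀ x : K, (closedBall (0 : K) R).indicator (1 : K → ℝ≥0∞) (E.𝔭 ^ (-(j : ℤ)) * x) =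
      (closedBall (0 : K) (‖E.𝔭‖ ^ j * R)).indicator 1 x := by
    intro x
    classical
    refine if_congr ?_ rfl rfl
    rw [mem_closedBall_zero_iff, mem_closedBall_zero_iff, norm_mul, zpow_neg, zpow_natCast,
      norm_inv, norm_pow, inv_mul_le_iff₀ (pow_pos E.norm_prime_pos j)]
  simp_rw [e] at h
  rw [lintegral_indicator_one measurableSet_closedBall,
    lintegral_indicator_one measurableSet_closedBall] at h
  rw [h, zpow_neg, zpow_natCast, inv_pow]

lemma enorm_integral_mul_conj_sq_le {α : Type*} [MeasurableSpace α] {ν : Measure α} {f g : α → ℂ}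
    (hf : MemLp f 2 ν) (hg : MemLp g 2 ν) :
    ‖∫ x, f x * conj (g x) ∂ν‖ₑ ^ 2 ≤ (∫⁻ x, ‖f x‖ₑ ^ 2 ∂ν) * ∫⁻ x, ‖g x‖ₑ ^ 2 ∂ν := by
  rw [← inner_toLp hf hg, ← eLpNorm_two_sq, ← eLpNorm_two_sq, ← mul_pow, mul_comm,
    ← Lp.enorm_toLp hf, ← Lp.enorm_toLp hg]
  gcongr
  rw [← ofReal_norm, ← ofReal_norm, ← ofReal_norm, ← ENNReal.ofReal_mul (norm_nonneg _)]
  exact ENNReal.ofReal_le_ofReal (norm_inner_le_norm _ _)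

/-- At coarse scales the energy tends to zero, since the dilates of `f` concentrate at the
origin. -/
lemma IsTest.tendsto_energy_atBot (hμ : μ (closedBall (0 : K) 1) = 1) {f φ Φ : K → ℂ}
    (hf : E.IsTest μ f) (hΦ : E.IsFourierTransform μ φ Φ) :
    Tendsto (fun j : ℕ => ∫ ξ in closedBall 0 1,
      ‖E.bracket (E.dil (-(j : ℤ)) (E.ft μ f)) Φ ξ‖ ^ 2 ∂μ) atTop (𝓝 0) := by
  obtain ⟨R, hR, -⟩ := hf.2
  set w : K → ℝ≥0∞ := fun x => ∑' k, ‖φ (x - E.u k)‖ₑ ^ 2 with hw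
  have hmeas : ∀ k, AEMeasurable (fun x => ‖φ (x - E.u k)‖ₑ ^ 2) μ := fun k =>
    (memLp_comp_sub hΦ.1 (E.u k)).1.enorm.pow_const 2
  have hwint : ∫⁻ x in closedBall 0 1, w x ∂μ ≠ ∞ := by
    rw [hw, lintegral_tsum fun k => (hmeas k).restrict, ← E.lintegral_eq_tsum_sub μ
      (fun x => ‖φ x‖ₑ ^ 2), lintegral_enorm_sq_eq hΦ.1]
    exact ENNReal.ofReal_ne_top
  have hball : Tendsto (fun j : ℕ => μ (closedBall (0 : K) (‖E.𝔭‖ ^ j * R))) atTop (𝓝 0) := by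
    simp_rw [measure_closedBall_prime_pow hμ]
    have hq : ((p : ℝ≥0) ^ c)⁻¹ < 1 := by
      have : (1 : ℝ≥0) < (p : ℝ≥0) ^ c := by exact_mod_cast E.one_lt_q
      exact inv_lt_one_of_one_lt₀ this
    have h1 : Tendsto (fun j : ℕ => ((((p : ℝ≥0) ^ c)⁻¹ ^ j : ℝ≥0) : ℝ≥0∞)) atTop (𝓝 0) :=
      ENNReal.tendsto_coe.2 (tendsto_pow_atTop_nhds_zero_of_lt_one zero_le hq)
    have := ENNReal.Tendsto.mul_const (b := μ (closedBall (0 : K) R)) h1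
      (Or.inr measure_closedBall_lt_top.ne)
    rwa [zero_mul] at this
  have hw0 : Tendsto (fun j : ℕ => ∫⁻ x in closedBall (0 : K) (‖E.𝔭‖ ^ j * R), w x
      ∂μ.restrict (closedBall 0 1)) atTop (𝓝 0) := by
    refine tendsto_setLIntegral_zero hwint ?_
    exact tendsto_of_tendsto_of_tendsto_of_le_of_le tendsto_const_nhds hball (fun _ => zero_le)
      fun j => Measure.restrict_apply_le _ _
  have hw1 := ENNReal.Tendsto.const_mul (a := ∫⁻ x, ‖f x‖ₑ ^ 2 ∂μ) hw0 (Or.inr (by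
    rw [lintegral_enorm_sq_eq hf.1]; exact ENNReal.ofReal_ne_top))
  rw [mul_zero] at hw1
  have hsmall : ∀ᶠ j : ℕ in atTop, ‖E.𝔭‖ ^ j * R < 1 := by
    have := (tendsto_pow_atTop_nhds_zero_of_lt_one E.norm_prime_pos.le
      E.norm_prime_lt_one).mul_const R
    rw [zero_mul] at this
    exact this.eventually (gt_mem_nhds one_pos)
  have hENN : Tendsto (fun j : ℕ => ENNReal.ofReal (∫ ξ in closedBall 0 1,
      ‖E.bracket (E.dil (-(j : ℤ)) (E.ft μ f)) Φ ξ‖ ^ 2 ∂μ)) atTop (𝓝 0) := by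
    refine tendsto_of_tendsto_of_tendsto_of_le_of_le' tendsto_const_nhds hw1
      (Eventually.of_forall fun _ => zero_le) ?_
    filter_upwards [hsmall] with j hj
    have hg := hf.dil hμ j
    have hsum := hg.hasSum_translates hμ hg hΦ hΦ
    rw [integral_mul_conj_self, E.ft_dil hμ] at hsum
    simp_rw [Complex.mul_conj, Complex.normSq_eq_norm_sq] at hsum
    have hsum' := Complex.hasSum_ofReal.1 hsum
    rw [← hsum'.tsum_eq, ENNReal.ofReal_tsum_of_nonneg (fun _ => by positivity) hsum'.summable,
      Measure.restrict_restrict_of_subset (closedBall_subset_closedBall hj.le), hw,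
      lintegral_tsum fun k => (hmeas k).restrict, ← ENNReal.tsum_mul_left]
    refine ENNReal.tsum_le_tsum fun k => ?_
    rw [ENNReal.ofReal_pow (norm_nonneg _), ofReal_norm]
    have hres : ∫ x, E.dil j f x * conj (φ (x - E.u k)) ∂μ =
        ∫ x in closedBall (0 : K) (‖E.𝔭‖ ^ j * R), E.dil j f x * conj (φ (x - E.u k)) ∂μ := by
      refine (setIntegral_eq_integral_of_forall_compl_eq_zero fun x hx => ?_).symm
      rw [mem_closedBall_zero_iff, not_le] at hx
      rw [E.dil_support j hR x (by rwa [zpow_natCast]), zero_mul]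
    rw [hres]
    refine (enorm_integral_mul_conj_sq_le (hg.1.restrict _)
      ((memLp_comp_sub hΦ.1 (E.u k)).restrict _)).trans ?_
    rw [← E.lintegral_dil hμ j f]
    exact mul_le_mul' (setLIntegral_le_lintegral _ _) le_rfl
  have := (ENNReal.tendsto_toReal ENNReal.zero_ne_top).comp hENN
  rw [ENNReal.toReal_zero] at this
  refine this.congr fun j => ?_
  exact ENNReal.toReal_ofReal (integral_nonneg fun _ => by positivity)

end Masks

/-! ### Parseval frames in Hilbert spaces -/

section Frames

lemma hasSum_prod_of_nonneg {α β : Type*} {f : α × β → ℝ} (hf : ∀ x, 0 ≤ f x) {g : α → ℝ} {a : ℝ}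
    (h : ∀ x, HasSum (fun y => f (x, y)) (g x)) (hg : HasSum g a) : HasSum f a := by
  have hs : Summable f := by
    refine (summable_prod_of_nonneg hf).2 ⟨fun x => (h x).summable, ?_⟩
    simp_rw [(h _).tsum_eq]
    exact hg.summable
  have := hs.hasSum.prod_fiberwise h
  rw [← this.unique hg]
  exact hs.hasSum

/-- A telescoping series over `ℤ`. -/
lemma hasSum_int_of_telescoping {P Q : ℤ → ℝ} {a : ℝ} (hQ : ∀ j, 0 ≤ Q j)
    (h : ∀ j, P j + Q j = P (j + 1)) (htop : Tendsto (fun n : ℕ => P n) atTop (𝓝 a))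
    (hbot : Tendsto (fun n : ℕ => P (-(n : ℤ))) atTop (𝓝 0)) : HasSum Q a := by
  have h1 : HasSum (fun n : ℕ => Q n) (a - P 0) := by
    rw [hasSum_iff_tendsto_nat_of_nonneg fun n => hQ n]
    refine (htop.sub_const (P 0)).congr fun n => ?_
    induction n with
    | zero => simp
    | succ n ih =>
      rw [Finset.sum_range_succ, ← ih]
      have := h n
      push_cast
      linarith
  have h2 : HasSum (fun n : ℕ => Q (-((n : ℤ) + 1))) (P 0 - 0) := by
    rw [hasSum_iff_tendsto_nat_of_nonneg fun n => hQ _]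
    refine (hbot.const_sub (P 0)).congr fun n => ?_
    induction n with
    | zero => simp
    | succ n ih =>
      rw [Finset.sum_range_succ, ← ih]
      have := h (-((n : ℤ) + 1))
      rw [neg_add, neg_add_cancel_right] at this
      push_cast
      rw [neg_add]
      linarith
  simpa using h1.of_nat_of_neg_add_one h2

variable {H ι : Type*} [NormedAddCommGroup H] [InnerProductSpace ℂ H]

/-- A family satisfying Parseval's identity on a dense subspace has an isometric analysis operator
into `ℓ²`. -/
lemma exists_analysis {S : Submodule ℂ H} (hS : Dense (S : Set H)) {v : ι → H}
    (hv : ∀ x ∈ S, HasSum (fun i => ‖inner ℂ (v i) x‖ ^ 2) (‖x‖ ^ 2)) :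
    ∃ T : H →L[ℂ] lp (fun _ : ι => ℂ) 2, (∀ x i, T x i = inner ℂ (v i) x) ∧
      ∀ x, ‖T x‖ = ‖x‖ := by
  have hB : ∀ s : Finset ι, ∀ x : H, ∑ i ∈ s, ‖inner ℂ (v i) x‖ ^ 2 ≤ ‖x‖ ^ 2 := by
    intro s x
    refine isClosed_property (p := fun x : H => ∑ i ∈ s, ‖inner ℂ (v i) x‖ ^ 2 ≤ ‖x‖ ^ 2)
      (e := fun x : S => (x : H)) ?_ ?_ ?_ x
    · exact hS.denseRange_val
    · exact isClosed_le (by fun_prop) (by fun_prop)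
    · exact fun x => sum_le_hasSum s (fun _ _ => by positivity) (hv x x.2)
  have hM : ∀ x : H, Memℓp (fun i => inner ℂ (v i) x) 2 := fun x => by
    refine memℓp_gen' (C := ‖x‖ ^ 2) fun s => ?_
    simpa using hB s x
  let T₀ : H →ₗ[ℂ] lp (fun _ : ι => ℂ) 2 :=
    { toFun := fun x => ⟨fun i => inner ℂ (v i) x, hM x⟩
      map_add' := fun x y => by ext i; exact inner_add_right _ _ _
      map_smul' := fun a x => by ext i; exact inner_smul_right _ _ _ }
  have hT₀ : ∀ x i, T₀ x i = inner ℂ (v i) x := fun _ _ => rfl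
  have hnorm : ∀ x, HasSum (fun i => ‖inner ℂ (v i) x‖ ^ 2) (‖T₀ x‖ ^ 2) := fun x => by
    have := lp.hasSum_norm (p := 2) (by norm_num) (T₀ x)
    simpa [hT₀] using this
  have hle : ∀ x, ‖T₀ x‖ ≤ 1 * ‖x‖ := fun x => by
    rw [one_mul]
    refine (sq_le_sq₀ (norm_nonneg _) (norm_nonneg _)).1 ?_
    exact hasSum_le_of_sum_le (hnorm x) fun s => hB s x
  refine ⟨T₀.mkContinuous 1 hle, fun x i => rfl, fun x => ?_⟩
  refine isClosed_property (p := fun x : H => ‖T₀.mkContinuous 1 hle x‖ = ‖x‖)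
    (e := fun x : S => (x : H)) ?_ ?_ ?_ x
  · exact hS.denseRange_val
  · exact isClosed_eq (by fun_prop) (by fun_prop)
  · intro x
    have := (hnorm x).unique (hv x x.2)
    exact (sq_eq_sq₀ (norm_nonneg _) (norm_nonneg _)).1 this

lemma hasSum_of_analysis {v : ι → H} {T : H →L[ℂ] lp (fun _ : ι => ℂ) 2}
    (hT : ∀ x i, T x i = inner ℂ (v i) x) (hn : ∀ x, ‖T x‖ = ‖x‖) (x : H) :
    HasSum (fun i => ‖inner ℂ (v i) x‖ ^ 2) (‖x‖ ^ 2) := by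
  have := lp.hasSum_norm (p := 2) (by norm_num) (T x)
  simpa [hT, hn] using this

/-- If the ranges of two analysis operators are orthogonal, the mixed frame operator is zero, with
unconditional convergence of its series. -/
lemma hasSum_mixed_of_analysis [CompleteSpace H] {S : Submodule ℂ H} (hS : Dense (S : Set H))
    {v w : ι → H} {T U : H →L[ℂ] lp (fun _ : ι => ℂ) 2} (hT : ∀ x i, T x i = inner ℂ (v i) x)
    (hU : ∀ x i, U x i = inner ℂ (w i) x) (h : ∀ x ∈ S, ∀ y ∈ S, inner ℂ (U y) (T x) = 0)
    (x : H) : HasSum (fun i => inner ℂ (v i) x • w i) 0 := by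
  have h1 : ∀ x y : H, inner ℂ (U y) (T x) = 0 := by
    intro x y
    refine isClosed_property2 (p := fun x y : H => inner ℂ (U y) (T x) = 0)
      (e := fun x : S => (x : H)) ?_ ?_ ?_ x y
    · exact hS.denseRange_val
    · exact isClosed_eq (by fun_prop) continuous_const
    · exact fun x y => h x x.2 y y.2
  classical
  have h2 := (lp.hasSum_single (p := 2) (by norm_num) (T x)).mapL (ContinuousLinearMap.adjoint U)
  have h3 : ContinuousLinearMap.adjoint U (T x) = 0 := by
    refine ext_inner_left ℂ fun y => ?_
    rw [ContinuousLinearMap.adjoint_inner_right, h1, inner_zero_right]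
  rw [h3] at h2
  refine h2.congr_fun fun i => ?_
  refine ext_inner_left ℂ fun y => ?_
  rw [ContinuousLinearMap.adjoint_inner_right, lp.inner_single_right, hT, hU, inner_smul_right,
    ← inner_conj_symm y (w i)]
  rfl

end Frames

/-! ### Density of the test functions -/

section Density

variable {K : Type*} [NontriviallyNormedField K] {p c : ℕ} {E : LocalFieldData K p c}
  [hp : Fact p.Prime] [IsUltrametricDist K] [ProperSpace K] [MeasurableSpace K] [BorelSpace K]
  {μ : Measure K} [μ.IsAddHaarMeasure]

variable (E) in
/-- The Gabor functions `χ(u(k) x) 1_{u(l) + 𝔇}(x)` are test functions. -/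
lemma isTest_gabor (k l : ℕ) :
    E.IsTest μ ((closedBall (E.u l) 1).indicator fun x => (E.χ (E.u k * x) : ℂ)) := by
  refine ⟨?_, max 1 (max ‖E.u k‖ ‖E.u l‖), fun x hx => ?_, fun ξ hξ => ?_⟩
  · rw [memLp_indicator_iff_restrict measurableSet_closedBall]
    have : IsFiniteMeasure (μ.restrict (closedBall (E.u l) 1)) :=
      ⟨by rw [Measure.restrict_apply_univ]; exact measure_closedBall_lt_top⟩
    exact MemLp.of_bound (E.continuous_χ_mul _).aestronglyMeasurable 1
      (ae_of_all _ fun x => (E.norm_χ _).le)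
  · refine Set.indicator_of_notMem (fun hmem => ?_) _
    rw [mem_closedBall, dist_eq_norm] at hmem
    have := norm_add_le_of_le (r := max 1 (max ‖E.u k‖ ‖E.u l‖)) (hmem.trans (le_max_left _ _))
      ((le_max_right ‖E.u k‖ ‖E.u l‖).trans (le_max_right _ _))
    rw [sub_add_cancel] at this
    exact hx.not_ge this
  · have h1 : 1 < ‖E.u k - ξ‖ := by
      by_contra! hle
      have := norm_sub_le_of_le (r := max 1 (max ‖E.u k‖ ‖E.u l‖))
        ((le_max_left ‖E.u k‖ ‖E.u l‖).trans (le_max_right _ _)) (hle.trans (le_max_left _ _))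
      rw [sub_sub_cancel] at this
      exact hξ.not_ge this
    have e : ∀ x, (closedBall (E.u l) 1).indicator (fun x => (E.χ (E.u k * x) : ℂ)) x *
        conj (E.χ (ξ * x) : ℂ) =
        (closedBall (E.u l) 1).indicator (fun x => (E.χ ((E.u k - ξ) * x) : ℂ)) x := by
      intro x
      by_cases hx : x ∈ closedBall (E.u l) 1
      · rw [Set.indicator_of_mem hx, Set.indicator_of_mem hx, E.conj_χ, ← E.coe_χ_add, sub_mul,
          sub_eq_add_neg]
      · rw [Set.indicator_of_notMem hx, Set.indicator_of_notMem hx, zero_mul]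
    rw [ft]
    simp_rw [e]
    rw [integral_indicator measurableSet_closedBall, setIntegral_closedBall_add]
    simp_rw [mul_add, E.coe_χ_add]
    rw [integral_mul_const, E.integral_χ_of_one_lt μ h1, zero_mul]

variable (E μ) in
/-- The subspace of `L²(K)` formed by the classes of test functions. -/
def testSubmodule : Submodule ℂ (Lp ℂ 2 μ) where
  carrier := {x | ∃ (f : K → ℂ) (hf : E.IsTest μ f), x = hf.1.toLp f}
  zero_mem' := ⟨fun _ => 0, ⟨MemLp.zero', 0, by simp [ft]⟩, by rfl⟩
  add_mem' := by
    rintro _ _ ⟨f, hf, rfl⟩ ⟨g, hg, rfl⟩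
    exact ⟨_, hf.add hg, (MemLp.toLp_add hf.1 hg.1).symm⟩
  smul_mem' := by
    rintro a _ ⟨f, hf, rfl⟩
    exact ⟨_, hf.const_mul a, (MemLp.toLp_const_smul a hf.1).symm⟩

/-- Test functions are dense: a function orthogonal to all Gabor functions has vanishing Fourier
coefficients on every coset of `𝔇`. -/
lemma dense_testSubmodule (hμ : μ (closedBall (0 : K) 1) = 1) :
    Dense (E.testSubmodule μ : Set (Lp ℂ 2 μ)) := by
  rw [Submodule.dense_iff_topologicalClosure_eq_top, Submodule.topologicalClosure_eq_top_iff,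
    Submodule.eq_bot_iff]
  intro x hx
  have hxL : MemLp x 2 μ := Lp.memLp x
  have hcoef : ∀ k l : ℕ,
      ∫ y in closedBall 0 1, x (y + E.u l) * conj (E.χ (E.u k * y) : ℂ) ∂μ = 0 := by
    intro k l
    have h1 := (Submodule.mem_orthogonal _ x).1 hx _ ⟨_, E.isTest_gabor (μ := μ) k l, rfl⟩
    conv at h1 => lhs; rw [← Lp.toLp_coeFn x hxL]
    rw [inner_toLp hxL (E.isTest_gabor k l).1] at h1
    rw [← h1]
    have e : ∀ y, x y * conj ((closedBall (E.u l) 1).indicator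
        (fun x => (E.χ (E.u k * x) : ℂ)) y) =
        (closedBall (E.u l) 1).indicator (fun y => x y * conj (E.χ (E.u k * y) : ℂ)) y := by
      intro y
      by_cases hy : y ∈ closedBall (E.u l) 1
      · rw [Set.indicator_of_mem hy, Set.indicator_of_mem hy]
      · rw [Set.indicator_of_notMem hy, Set.indicator_of_notMem hy, map_zero, mul_zero]
    simp_rw [e]
    rw [integral_indicator measurableSet_closedBall, setIntegral_closedBall_add μ _ (E.u l)]
    simp_rw [E.χ_u_mul_add_u]
  have hzero : ∀ l : ℕ, ∫⁻ y in closedBall 0 1, ‖x (y + E.u l)‖ₑ ^ 2 ∂μ = 0 := by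
    intro l
    have hL : MemLp (fun y => x (y + E.u l)) 2 (μ.restrict (closedBall 0 1)) :=
      (hxL.comp_measurePreserving (measurePreserving_add_right μ (E.u l))).restrict _
    have hP := E.hasSum_parseval hμ hL hL
    simp_rw [hcoef, zero_mul] at hP
    rw [integral_mul_conj_self] at hP
    have h0 : ∫ y in closedBall 0 1, ‖x (y + E.u l)‖ ^ 2 ∂μ = 0 := by
      exact_mod_cast hP.unique hasSum_zero
    rw [lintegral_enorm_sq_eq hL, h0, ENNReal.ofReal_zero]
  have hx0 : eLpNorm x 2 μ = 0 := by
    have := eLpNorm_two_sq μ x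
    rw [E.lintegral_eq_tsum μ] at this
    simp_rw [hzero, tsum_zero] at this
    exact (pow_eq_zero_iff two_ne_zero).1 this
  rw [← norm_eq_zero, Lp.norm_def, hx0, ENNReal.toReal_zero]

end Density

/-! ### The wavelet systems -/

section Wavelets

variable {K : Type*} [NontriviallyNormedField K] {p c : ℕ} {E : LocalFieldData K p c}
  [hp : Fact p.Prime] [IsUltrametricDist K] [ProperSpace K] [MeasurableSpace K] [BorelSpace K]
  {μ : Measure K} [μ.IsAddHaarMeasure]

lemma memLp_waveletSystem (hμ : μ (closedBall (0 : K) 1) = 1) {L : ℕ} {ψ : Fin L → K → ℂ}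
    (hψ : ∀ ℓ, MemLp (ψ ℓ) 2 μ) (i : Fin L × ℤ × ℕ) : MemLp (E.waveletSystem ψ i) 2 μ :=
  E.memLp_dil hμ i.2.1 (memLp_comp_sub (hψ i.1) (E.u i.2.2))

lemma waveletCoeff_eq (hμ : μ (closedBall (0 : K) 1) = 1) {L : ℕ} (ψ : Fin L → K → ℂ)
    (f : K → ℂ) (ℓ : Fin L) (j : ℤ) (k : ℕ) :
    E.waveletCoeff μ ψ f (ℓ, j, k) = ∫ x, E.dil (-j) f x * conj (ψ ℓ (x - E.u k)) ∂μ := by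
  rw [← integral_dil_mul_conj_dil (E := E) hμ j, dil_dil, add_neg_cancel, dil_zero]
  rfl

/-- The wavelet coefficients at scale `j` in terms of bracket products. -/
lemma IsTest.hasSum_waveletCoeff (hμ : μ (closedBall (0 : K) 1) = 1) {L : ℕ}
    {ψ ψ' Ψ Ψ' : Fin L → K → ℂ} (hψ : ∀ ℓ, E.IsFourierTransform μ (ψ ℓ) (Ψ ℓ))
    (hψ' : ∀ ℓ, E.IsFourierTransform μ (ψ' ℓ) (Ψ' ℓ)) {f g : K → ℂ} (hf : E.IsTest μ f)
    (hg : E.IsTest μ g) (ℓ : Fin L) (j : ℤ) :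
    HasSum (fun k : ℕ => E.waveletCoeff μ ψ f (ℓ, j, k) * conj (E.waveletCoeff μ ψ' g (ℓ, j, k)))
      (∫ ξ in closedBall 0 1, E.bracket (E.ft μ (E.dil (-j) f)) (Ψ ℓ) ξ *
        conj (E.bracket (E.ft μ (E.dil (-j) g)) (Ψ' ℓ) ξ) ∂μ) := by
  simp_rw [waveletCoeff_eq hμ]
  exact (hf.dil hμ (-j)).hasSum_translates hμ (hg.dil hμ (-j)) (hψ ℓ) (hψ' ℓ)

/-- Parseval's identity for test functions: the energies of the wavelet coefficients at the
different scales telescope. -/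
lemma IsTest.hasSum_waveletCoeff_sq (hμ : μ (closedBall (0 : K) 1) = 1) {L : ℕ}
    {d : Fin (L + 1) → ℕ → ℂ} {m : Fin (L + 1) → K → ℂ} (hm : ∀ ℓ, E.IsMask μ (d ℓ) (m ℓ))
    {φ Φ : K → ℂ} (hφ : E.IsRefinable μ (d 0) φ) (hΦ : E.IsFourierTransform μ φ Φ)
    (hlim : ∀ᵐ ξ ∂μ, Tendsto (fun j : ℕ => ‖Φ (E.𝔭 ^ j * ξ)‖) atTop (𝓝 1))
    (hM : ∀ k : ℕ, 1 ≤ k → k < p ^ c → ∀ᵐ ξ ∂μ,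
      (maskMatrix m (E.𝔭 * E.u k) ξ)ᴴ * maskMatrix m (E.𝔭 * E.u k) ξ = 1)
    {ψ : Fin L → K → ℂ} (hψ : ∀ ℓ, E.IsFourierTransform μ (ψ ℓ)
      (fun ξ => m ℓ.succ (E.𝔭 * ξ) * Φ (E.𝔭 * ξ))) {f : K → ℂ} (hf : E.IsTest μ f) :
    HasSum (fun i => ‖E.waveletCoeff μ ψ f i‖ ^ 2) (∫ x, ‖f x‖ ^ 2 ∂μ) := by
  set Ψ : Fin L → K → ℂ := fun ℓ ξ => m ℓ.succ (E.𝔭 * ξ) * Φ (E.𝔭 * ξ) with hΨ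
  have href := hφ.ae_eq hμ (hm 0) hΦ
  have hle : ∀ᵐ ξ ∂μ, ‖Φ ξ‖ ≤ 1 :=
    ae_norm_refinable_le_one hμ href (ae_norm_mask_le_one hM 0) hlim
  set F := E.ft μ f
  have hF : ∀ j : ℤ, E.ft μ (E.dil (-j) f) = E.dil j F := fun j => by rw [E.ft_dil hμ, neg_neg]
  set P : ℤ → ℝ := fun j => ∫ ξ in closedBall 0 1, ‖E.bracket (E.dil j F) Φ ξ‖ ^ 2 ∂μ with hP
  set Q : Fin L → ℤ → ℝ := fun ℓ j =>
    ∫ ξ in closedBall 0 1, ‖E.bracket (E.dil j F) (Ψ ℓ) ξ‖ ^ 2 ∂μ with hQ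
  have hcoef : ∀ ℓ j, HasSum (fun k : ℕ => ‖E.waveletCoeff μ ψ f (ℓ, j, k)‖ ^ 2) (Q ℓ j) := by
    intro ℓ j
    have := hf.hasSum_waveletCoeff hμ hψ hψ hf ℓ j
    rw [integral_mul_conj_self, hF] at this
    simp_rw [Complex.mul_conj, Complex.normSq_eq_norm_sq] at this
    exact Complex.hasSum_ofReal.1 this
  have hstep : ∀ j, P j + ∑ ℓ, Q ℓ j = P (j + 1) := by
    intro j
    have hfj := hf.dil hμ (-j)
    -- the refinable function joins the wavelets as the generator with index `0`
    have key := hfj.sum_integral_bracket hμ hfj hΦ.2.1 hΦ.2.1 (m := m) (m' := m)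
      (Ψ := Fin.cons Φ Ψ) (Ψ' := Fin.cons Φ Ψ)
      (Fin.cases hΦ.2.1 fun ℓ => (hψ ℓ).2.1) (Fin.cases hΦ.2.1 fun ℓ => (hψ ℓ).2.1)
      (fun ℓ n => (hm ℓ).ae_add_u n) (fun ℓ n => (hm ℓ).ae_add_u n)
      (Fin.cases href fun ℓ => ae_eq_rfl) (Fin.cases href fun ℓ => ae_eq_rfl) 1
      (ae_sum_conj_mul_eq 1 (by simpa using hM))
    rw [Fin.sum_univ_succ, hF, dil_dil, add_comm 1 j, one_mul] at key
    simp only [Fin.cons_zero, Fin.cons_succ, integral_mul_conj_self] at key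
    exact_mod_cast key
  have hQ0 : ∀ ℓ j, 0 ≤ Q ℓ j := fun ℓ j => integral_nonneg fun _ => by positivity
  have hscale : HasSum (fun j => ∑ ℓ, Q ℓ j) (∫ x, ‖f x‖ ^ 2 ∂μ) :=
    hasSum_int_of_telescoping (P := P) (fun j => Finset.sum_nonneg fun ℓ _ => hQ0 ℓ j) hstep
      (hf.tendsto_energy_atTop hμ hΦ.2.1 hle hlim) (hf.tendsto_energy_atBot hμ hΦ)
  have hprod : HasSum (fun i : ℤ × Fin L × ℕ => ‖E.waveletCoeff μ ψ f (i.2.1, i.1, i.2.2)‖ ^ 2)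
      (∫ x, ‖f x‖ ^ 2 ∂μ) :=
    hasSum_prod_of_nonneg (fun _ => by positivity)
      (fun j => hasSum_prod_of_nonneg (fun _ => by positivity) (fun ℓ => hcoef ℓ j)
        (hasSum_fintype _)) hscale
  let e : Fin L × ℤ × ℕ ≃ ℤ × Fin L × ℕ :=
    { toFun := fun i => (i.2.1, i.1, i.2.2), invFun := fun i => (i.2.1, i.1, i.2.2),
      left_inv := fun _ => rfl, right_inv := fun _ => rfl }
  exact e.hasSum_iff.2 hprod

lemma norm_toLp_sq {f : K → ℂ} (hf : MemLp f 2 μ) : ‖hf.toLp f‖ ^ 2 = ∫ x, ‖f x‖ ^ 2 ∂μ := by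
  have h := inner_toLp hf hf
  rw [integral_mul_conj_self, inner_self_eq_norm_sq_to_K] at h
  exact Complex.ofReal_injective ((Complex.ofReal_pow _ _).trans h)

lemma toLp_sum {ι : Type*} (s : Finset ι) (a : ι → ℂ) {f : ι → K → ℂ} (hf : ∀ i, MemLp (f i) 2 μ)
    (h : MemLp (fun x => ∑ i ∈ s, a i * f i x) 2 μ) :
    h.toLp _ = ∑ i ∈ s, a i • (hf i).toLp (f i) := by
  classical
  induction s using Finset.induction_on with
  | empty => simp only [Finset.sum_empty]; rfl
  | insert i s hi ih =>
    have hs : MemLp (fun x => ∑ i ∈ s, a i * f i x) 2 μ :=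
      memLp_finsetSum _ fun i _ => (hf i).const_mul (a i)
    rw [Finset.sum_insert hi, ← ih hs, ← MemLp.toLp_const_smul, ← MemLp.toLp_add]
    congr 1
    funext x
    simp [Finset.sum_insert hi]

/-- A system satisfying Parseval's identity for test functions has an isometric analysis
operator on `L²(K)`. -/
lemma exists_wavelet_analysis (hμ : μ (closedBall (0 : K) 1) = 1) {L : ℕ} {ψ : Fin L → K → ℂ}
    (hψ : ∀ ℓ, MemLp (ψ ℓ) 2 μ) (h : ∀ f, E.IsTest μ f →
      HasSum (fun i => ‖E.waveletCoeff μ ψ f i‖ ^ 2) (∫ x, ‖f x‖ ^ 2 ∂μ)) :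
    ∃ T : Lp ℂ 2 μ →L[ℂ] lp (fun _ : Fin L × ℤ × ℕ => ℂ) 2,
      (∀ x i, T x i = inner ℂ ((memLp_waveletSystem (E := E) hμ hψ i).toLp _) x) ∧
        ∀ x, ‖T x‖ = ‖x‖ := by
  refine exists_analysis (dense_testSubmodule (E := E) hμ) ?_
  rintro _ ⟨f, hf, rfl⟩
  simp_rw [inner_toLp hf.1, norm_toLp_sq]
  exact h f hf

lemma isParsevalWaveletFrame_of_analysis (hμ : μ (closedBall (0 : K) 1) = 1) {L : ℕ}
    {ψ : Fin L → K → ℂ} (hψ : ∀ ℓ, MemLp (ψ ℓ) 2 μ)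
    {T : Lp ℂ 2 μ →L[ℂ] lp (fun _ : Fin L × ℤ × ℕ => ℂ) 2}
    (hT : ∀ x i, T x i = inner ℂ ((memLp_waveletSystem (E := E) hμ hψ i).toLp _) x)
    (hn : ∀ x, ‖T x‖ = ‖x‖) : E.IsParsevalWaveletFrame μ ψ := by
  refine ⟨one_pos, one_pos, hψ, fun f hf => ?_⟩
  have h := hasSum_of_analysis hT hn (hf.toLp f)
  simp_rw [inner_toLp hf, norm_toLp_sq] at h
  have h' : HasSum (fun i => ‖E.waveletCoeff μ ψ f i‖ ^ 2) (∫ x, ‖f x‖ ^ 2 ∂μ) := h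
  refine ⟨h'.summable, ?_, ?_⟩ <;> rw [h'.tsum_eq, one_mul]

/-- The mixed Gram sums of two systems vanish scale by scale when the columns of their wavelet
masks are orthogonal. -/
lemma IsTest.tsum_mixed_eq_zero (hμ : μ (closedBall (0 : K) 1) = 1) {L : ℕ}
    {d d' : Fin L → ℕ → ℂ} {m m' : Fin L → K → ℂ} (hm : ∀ ℓ, E.IsMask μ (d ℓ) (m ℓ))
    (hm' : ∀ ℓ, E.IsMask μ (d' ℓ) (m' ℓ)) {Φ Φ' : K → ℂ} (hΦ : MemLp Φ 2 μ) (hΦ' : MemLp Φ' 2 μ)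
    (hM : ∀ k : ℕ, 1 ≤ k → k < p ^ c → ∀ᵐ ξ ∂μ,
      (maskMatrix m (E.𝔭 * E.u k) ξ)ᴴ * maskMatrix m' (E.𝔭 * E.u k) ξ = 0)
    {ψ ψ' : Fin L → K → ℂ}
    (hψ : ∀ ℓ, E.IsFourierTransform μ (ψ ℓ) (fun ξ => m ℓ (E.𝔭 * ξ) * Φ (E.𝔭 * ξ)))
    (hψ' : ∀ ℓ, E.IsFourierTransform μ (ψ' ℓ) (fun ξ => m' ℓ (E.𝔭 * ξ) * Φ' (E.𝔭 * ξ)))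
    {f g : K → ℂ} (hf : E.IsTest μ f) (hg : E.IsTest μ g)
    (hs : Summable fun i => E.waveletCoeff μ ψ f i * conj (E.waveletCoeff μ ψ' g i)) :
    ∑' i, E.waveletCoeff μ ψ f i * conj (E.waveletCoeff μ ψ' g i) = 0 := by
  let e : ℤ × Fin L × ℕ ≃ Fin L × ℤ × ℕ :=
    { toFun := fun i => (i.2.1, i.1, i.2.2), invFun := fun i => (i.2.1, i.1, i.2.2),
      left_inv := fun _ => rfl, right_inv := fun _ => rfl }
  have hs' := e.summable_iff.2 hs
  rw [← e.tsum_eq]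
  rw [show (∑' i, E.waveletCoeff μ ψ f (e i) * conj (E.waveletCoeff μ ψ' g (e i))) =
    ∑' j, ∑' i : Fin L × ℕ, _ from hs'.tsum_prod]
  refine (tsum_congr fun j => ?_).trans tsum_zero
  rw [(hs'.prod_factor j).tsum_prod, tsum_fintype]
  have hfj := hf.dil hμ (-j)
  have key := hfj.sum_integral_bracket hμ (hg.dil hμ (-j)) hΦ hΦ' (m := m) (m' := m')
    (fun ℓ => (hψ ℓ).2.1) (fun ℓ => (hψ' ℓ).2.1)
    (fun ℓ n => (hm ℓ).ae_add_u n) (fun ℓ n => (hm' ℓ).ae_add_u n)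
    (fun ℓ => ae_eq_rfl) (fun ℓ => ae_eq_rfl) 0 (ae_sum_conj_mul_eq 0 (by simpa using hM))
  rw [zero_mul] at key
  rw [← key]
  exact Finset.sum_congr rfl fun ℓ _ => (hf.hasSum_waveletCoeff hμ hψ hψ' hg ℓ j).tsum_eq

end Wavelets

end LocalFieldData

open LocalFieldData in
theorem theorem3p2 {K : Type*} [NontriviallyNormedField K] [IsUltrametricDist K]
    [LocallyCompactSpace K] [MeasurableSpace K] [BorelSpace K]
    (p c : ℕ) [Fact p.Prime] [CharP K p] (E : LocalFieldData K p c)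
    (μ : Measure K) [μ.IsAddHaarMeasure] (hμ : μ (Metric.closedBall (0 : K) 1) = 1)
    (L : ℕ)
    -- the coefficients of the masks (those with index `0` are the refinement coefficients)
    (d d' : Fin (L + 1) → ℕ → ℂ)
    (m m' : Fin (L + 1) → K → ℂ)
    (hm : ∀ ℓ, E.IsMask μ (d ℓ) (m ℓ)) (hm' : ∀ ℓ, E.IsMask μ (d' ℓ) (m' ℓ))
    -- the two refinable functions, their Fourier transforms and normalization
    (φ φ' φhat φhat' : K → ℂ)
    (hφ : E.IsRefinable μ (d 0) φ) (hφ' : E.IsRefinable μ (d' 0) φ')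
    (hφhat : E.IsFourierTransform μ φ φhat) (hφhat' : E.IsFourierTransform μ φ' φhat')
    (hlim : ∀ᵐ ξ ∂μ, Tendsto (fun j : ℕ => ‖φhat (E.𝔭 ^ j * ξ)‖) atTop (𝓝 1))
    (hlim' : ∀ᵐ ξ ∂μ, Tendsto (fun j : ℕ => ‖φhat' (E.𝔭 ^ j * ξ)‖) atTop (𝓝 1))
    -- the matrix equations
    (hM : ∀ k : ℕ, 1 ≤ k → k < p ^ c → ∀ᵐ ξ ∂μ,
      (maskMatrix m (E.𝔭 * E.u k) ξ)ᴴ * maskMatrix m (E.𝔭 * E.u k) ξ = 1)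
    (hM' : ∀ k : ℕ, 1 ≤ k → k < p ^ c → ∀ᵐ ξ ∂μ,
      (maskMatrix m' (E.𝔭 * E.u k) ξ)ᴴ * maskMatrix m' (E.𝔭 * E.u k) ξ = 1)
    (hM₀ : ∀ k : ℕ, 1 ≤ k → k < p ^ c → ∀ᵐ ξ ∂μ,
      (maskMatrix (fun ℓ : Fin L => m ℓ.succ) (E.𝔭 * E.u k) ξ)ᴴ *
        maskMatrix (fun ℓ : Fin L => m' ℓ.succ) (E.𝔭 * E.u k) ξ = 0)
    -- the generators
    (ψ ψ' : Fin L → K → ℂ)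
    (hψ : ∀ ℓ, E.IsFourierTransform μ (ψ ℓ) (fun ξ => m ℓ.succ (E.𝔭 * ξ) * φhat (E.𝔭 * ξ)))
    (hψ' : ∀ ℓ, E.IsFourierTransform μ (ψ' ℓ)
      (fun ξ => m' ℓ.succ (E.𝔭 * ξ) * φhat' (E.𝔭 * ξ))) :
    E.IsParsevalWaveletFrame μ ψ ∧ E.IsParsevalWaveletFrame μ ψ' ∧ E.AreOrthogonal μ ψ ψ' := by
  have : ProperSpace K := .of_locallyCompactSpace K
  have hψL : ∀ ℓ, MemLp (ψ ℓ) 2 μ := fun ℓ => (hψ ℓ).1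
  have hψL' : ∀ ℓ, MemLp (ψ' ℓ) 2 μ := fun ℓ => (hψ' ℓ).1
  obtain ⟨T, hT, hTn⟩ := exists_wavelet_analysis (E := E) hμ hψL fun f hf =>
    hf.hasSum_waveletCoeff_sq hμ hm hφ hφhat hlim hM hψ
  obtain ⟨U, hU, hUn⟩ := exists_wavelet_analysis (E := E) hμ hψL' fun f hf =>
    hf.hasSum_waveletCoeff_sq hμ hm' hφ' hφhat' hlim' hM' hψ'
  refine ⟨isParsevalWaveletFrame_of_analysis hμ hψL hT hTn,
    isParsevalWaveletFrame_of_analysis hμ hψL' hU hUn, fun f hf => ?_⟩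
  have horth : ∀ x ∈ E.testSubmodule μ, ∀ y ∈ E.testSubmodule μ, inner ℂ (U y) (T x) = 0 := by
    rintro _ ⟨f, hf, rfl⟩ _ ⟨g, hg, rfl⟩
    have h1 := lp.hasSum_inner (𝕜 := ℂ) (G := fun _ : Fin L × ℤ × ℕ => ℂ) (U (hg.1.toLp g))
      (T (hf.1.toLp f))
    simp_rw [hT, hU, inner_toLp hf.1, inner_toLp hg.1] at h1
    have h2 : HasSum (fun i => E.waveletCoeff μ ψ f i * conj (E.waveletCoeff μ ψ' g i))
      (inner ℂ (U (hg.1.toLp g)) (T (hf.1.toLp f))) := h1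
    rw [← h2.tsum_eq]
    exact hf.tsum_mixed_eq_zero hμ (fun ℓ => hm ℓ.succ) (fun ℓ => hm' ℓ.succ) hφhat.2.1
      hφhat'.2.1 hM₀ hψ hψ' hg h2.summable
  have h := hasSum_mixed_of_analysis (dense_testSubmodule (E := E) hμ) hT hU horth (hf.toLp f)
  simp_rw [inner_toLp hf] at h
  have h2 := (continuous_enorm.tendsto _).comp h
  rw [enorm_zero] at h2
  refine h2.congr fun s => ?_
  have hs : MemLp (fun x => ∑ i ∈ s, E.waveletCoeff μ ψ f i * E.waveletSystem ψ' i x) 2 μ :=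
    memLp_finsetSum _ fun i _ => (memLp_waveletSystem hμ hψL' i).const_mul _
  rw [← Lp.enorm_toLp hs, toLp_sum s _ (memLp_waveletSystem hμ hψL') hs]
  rfl
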